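/- Let $\Sigma_s$ (static symbols) and $\Sigma_p$ (parameter symbols) be disjoint finite alphabets, with $\Sigma_s$ linearly ordered and every static symbol regarded as smaller than every integer. A p-string is a string over $\Sigma_s \cup \Sigma_p$. Two p-strings $x, y$ p-match if some bijection of $\Sigma_p$, applied to every occurrence of a parameter symbol in $x$, transforms $x$ into $y$. The prev-encoding $\langle w\rangle$ of a p-string $w$ keeps each static symbol and replaces each occurrence of a parameter symbol by the distance to the previous occurrence of the same symbol in $w$, or by $0$ if there is none. Let $T$ be a p-string of length $n \ge 1$ whose last symbol is the smallest symbol $\$$ of $\Sigma_s$, where $\$$ occurs nowhere else in $T$. For $1 \le i \le n$ let $T_i = T[i..n]\,T[1..i-1]$, and let $\tau$ be the permutation of $\{1,\dots,n\}$ such that $\langle T_{\tau[1]}\rangle < \dots < \langle T_{\tau[n]}\rangle$ in lexicographic order. The parameterized Burrows–Wheeler transform (pBWT) of $T$ is the string $L$ of length $n$ in which $L[i]$ is the last symbol of $T_{\tau[i]}$ if that symbol is static, and otherwise is the number of $0$s in $\langle T_{\tau[i]}[1..j]\rangle$, where $j$ is the leftmost position at which the last symbol of $T_{\tau[i]}$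 occurs in $T_{\tau[i]}$. **Theorem.** There is an algorithm that, given only the pBWT $L$ of such a p-string $T$ of length $n$, computes a p-string that p-matches $T$, in $O(n^2)$ time and $O(n)$ space (words) on a word RAM. Here one fixed program and one constant $C$ serve all alphabets, all $T$ and all word sizes: each symbol of $L$ is stored in two words (a tag telling static symbols from integers, and its value), static symbols are represented by integers that preserve their order, and parameter symbols are represented in the output by $0, \dots, |\Sigma_p|-1$ under any fixed enumeration of $\Sigma_p$. Whenever words range over $\{0,\dots,B-1\}$ with $B \ge Cn$ and every code of a static symbol is less than $B$, the program halts after at most $Cn^2$ steps, uses only the first $Cn$ memory cells (input and output included) and a fixed number of registers, and never produces a number outside $\{0,\dots,B-1\}$. -/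

import Mathlib

namespace PBWT

/-! ### Parameterized strings

`S` is the set of static symbols, `P` the set of parameter symbols, and a p-string is a
`List (S ⊕ P)`.  Encoded strings are over `S ⊕ ℕ`. -/

/-- Two p-strings p-match if a bijection of the parameter symbols, applied to every occurrence
of a parameter symbol, transforms the first into the second. -/
def PMatch {S P : Type*} (x y : List (S ⊕ P)) : Prop :=
  ∃ f : Equiv.Perm P, x.map (Sum.map id f) = y

/-- The symbol of the prev-encoding that stands for the symbol `c` preceded by `u`: a static
symbol is kept; a parameter symbol becomes the distance to its previous occurrence, that is,
one more than its first index in `u` read backwards, or `0` if it does not occur in `u`. -/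
def prevSymbol {S P : Type*} [DecidableEq S] [DecidableEq P]
    (u : List (S ⊕ P)) (c : S ⊕ P) : S ⊕ ℕ :=
  match c with
  | Sum.inl s => Sum.inl s
  | Sum.inr p =>
      match u.reverse.findIdx? (fun x => decide (x = Sum.inr p)) with
      | none => Sum.inr 0
      | some k => Sum.inr (k + 1)

/-- The prev-encoding of a p-string. -/
def prevEnc {S P : Type*} [DecidableEq S] [DecidableEq P]
    (w : List (S ⊕ P)) : List (S ⊕ ℕ) :=
  List.ofFn fun i : Fin w.length => prevSymbol (w.take i) (w.get i)

/-- The number of occurrences of the integer `0` in an encoded string. -/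
def zeros {S : Type*} [DecidableEq S] (W : List (S ⊕ ℕ)) : ℕ :=
  W.countP fun x => decide (x = Sum.inr 0)

/-- The prev-encoding as an element of the lexicographically ordered strings over the ordered
alphabet `S ⊕ₗ ℕ`, in which every static symbol is smaller than every integer. -/
def sortKey {S P : Type*} [LinearOrder S] [DecidableEq P]
    (w : List (S ⊕ P)) : List (S ⊕ₗ ℕ) :=
  (prevEnc w).map toLex

/-- `T` ends with the smallest static symbol, which occurs nowhere else in `T`. -/
def EndMarked {S P : Type*} [LinearOrder S] (T : List (S ⊕ P)) : Prop :=
  ∃ (d : S) (u : List (S ⊕ P)),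
    (∀ s, d ≤ s) ∧ Sum.inl d ∉ u ∧ T = u ++ [Sum.inl d]

/-- The permutation `τ` that sorts the cyclic rotations of `T` by the lexicographic order of
their prev-encodings (positions counted from `0`).  If `T` is end-marked, these encodings are
pairwise distinct, so `τ` is the only such permutation. -/
def tau {S P : Type*} [LinearOrder S] [DecidableEq P]
    (T : List (S ⊕ P)) : Equiv.Perm (Fin T.length) :=
  Tuple.sort fun i : Fin T.length => sortKey (T.rotate i)

/-- The pBWT symbol of a rotation `w`: its last symbol if that is static; otherwise the number
of `0` in the prev-encoding of the prefix of `w` that ends at the leftmost occurrence of its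
last symbol.  (The value for the empty string is irrelevant.) -/
def rotSymbol {S P : Type*} [DecidableEq S] [DecidableEq P]
    (w : List (S ⊕ P)) : S ⊕ ℕ :=
  match w.getLast? with
  | none => Sum.inr 0
  | some (Sum.inl s) => Sum.inl s
  | some (Sum.inr p) =>
      Sum.inr (zeros (prevEnc (w.take (w.findIdx (fun x => decide (x = Sum.inr p)) + 1))))

/-- The parameterized Burrows-Wheeler transform of `T`. -/
def pbwt {S P : Type*} [LinearOrder S] [DecidableEq P]
    (T : List (S ⊕ P)) : List (S ⊕ ℕ) :=
  List.ofFn fun i : Fin T.length => rotSymbol (T.rotate (tau T i))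

/-! ### The word RAM

A random access machine whose programs are written in structured form.  It has registers, of
which a program uses finitely many, and a memory of `M` cells.  Registers and memory cells hold
words, the numbers below `B`.  Every instruction and every evaluation of a test takes one unit
of time. -/

/-- An operand: the content of a register, or a constant. -/
inductive Operand where
  | reg (r : ℕ) : Operand
  | imm (k : ℕ) : Operand

/-- The tests of conditional statements and loops. -/
inductive Test where
  | lt (a b : Operand) : Test
  | eq (a b : Operand) : Test

/-- Programs. -/
inductive Prog where
  | skip : Prog
  | set (r : ℕ) (a : Operand) : Prog
  | add (r : ℕ) (a b : Operand) : Prog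
  | sub (r : ℕ) (a b : Operand) : Prog
  | load (r : ℕ) (a : Operand) : Prog
  | store (a b : Operand) : Prog
  | seq (p q : Prog) : Prog
  | ite (c : Test) (p q : Prog) : Prog
  | while (c : Test) (p : Prog) : Prog

/-- The contents of the registers and of the memory. -/
structure State where
  reg : ℕ → ℕ
  mem : ℕ → ℕ

/-- The value of an operand. -/
def Operand.val (σ : State) : Operand → ℕ
  | Operand.reg r => σ.reg r
  | Operand.imm k => k

/-- The truth of a test. -/
def Test.holds (σ : State) : Test → Prop
  | Test.lt a b => a.val σ < b.val σ
  | Test.eq a b => a.val σ = b.val σ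

/-- Writing a register. -/
def State.setReg (σ : State) (r v : ℕ) : State :=
  { σ with reg := Function.update σ.reg r v }

/-- Writing a memory cell. -/
def State.setMem (σ : State) (a v : ℕ) : State :=
  { σ with mem := Function.update σ.mem a v }

/-- `Exec M B p σ t σ'`: on a machine with `M` memory cells and with words below `B`, the program
`p`, started in `σ`, halts in `σ'` after exactly `t` time units.  An instruction that addresses a
cell outside the memory, or whose result is not a word, is an error: it has no execution. -/
inductive Exec (M B : ℕ) : Prog → State → ℕ → State → Prop where
  | skip (σ : State) : Exec M B Prog.skip σ 1 σ
  | set (σ : State) (r : ℕ) (a : Operand) (h : a.val σ < B) :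
      Exec M B (Prog.set r a) σ 1 (σ.setReg r (a.val σ))
  | add (σ : State) (r : ℕ) (a b : Operand) (h : a.val σ + b.val σ < B) :
      Exec M B (Prog.add r a b) σ 1 (σ.setReg r (a.val σ + b.val σ))
  | sub (σ : State) (r : ℕ) (a b : Operand) (h : a.val σ - b.val σ < B) :
      Exec M B (Prog.sub r a b) σ 1 (σ.setReg r (a.val σ - b.val σ))
  | load (σ : State) (r : ℕ) (a : Operand) (ha : a.val σ < M) (h : σ.mem (a.val σ) < B) :
      Exec M B (Prog.load r a) σ 1 (σ.setReg r (σ.mem (a.val σ)))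
  | store (σ : State) (a b : Operand) (ha : a.val σ < M) (h : b.val σ < B) :
      Exec M B (Prog.store a b) σ 1 (σ.setMem (a.val σ) (b.val σ))
  | seq (p q : Prog) (σ σ' σ'' : State) (t t' : ℕ)
      (hp : Exec M B p σ t σ') (hq : Exec M B q σ' t' σ'') :
      Exec M B (Prog.seq p q) σ (t + t') σ''
  | ite_true (c : Test) (p q : Prog) (σ σ' : State) (t : ℕ) (hc : c.holds σ)
      (hp : Exec M B p σ t σ') :
      Exec M B (Prog.ite c p q) σ (t + 1) σ'
  | ite_false (c : Test) (p q : Prog) (σ σ' : State) (t : ℕ) (hc : ¬ c.holds σ)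
      (hq : Exec M B q σ t σ') :
      Exec M B (Prog.ite c p q) σ (t + 1) σ'
  | while_true (c : Test) (p : Prog) (σ σ' σ'' : State) (t t' : ℕ) (hc : c.holds σ)
      (hp : Exec M B p σ t σ') (hw : Exec M B (Prog.while c p) σ' t' σ'') :
      Exec M B (Prog.while c p) σ (t + 1 + t') σ''
  | while_false (c : Test) (p : Prog) (σ : State) (hc : ¬ c.holds σ) :
      Exec M B (Prog.while c p) σ 1 σ

/-! ### Strings in memory -/

/-- A string over a disjoint union is stored with two cells for each symbol: a tag that says to
which of the two alphabets the symbol belongs, then its code. -/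
def encode {α β : Type*} (f : α → ℕ) (g : β → ℕ) (w : List (α ⊕ β)) : List ℕ :=
  w.flatMap (Sum.elim (fun a => [0, f a]) (fun b => [1, g b]))

/-- The initial state on input `L`: the encoding of `L` stands at the beginning of the memory, its
number of symbols is in register `0`, and everything else is `0`. -/
def inputState {S : Type*} (scode : S → ℕ) (L : List (S ⊕ ℕ)) : State where
  reg := fun r => if r = 0 then L.length else 0
  mem := fun a => (encode scode id L).getD a 0

/-- The encoding of the p-string `w` stands at the beginning of the memory. -/
def Outputs {S P : Type*} (scode : S → ℕ) (pcode : P → ℕ) (σ : State) (w : List (S ⊕ P)) :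
    Prop :=
  ∀ a < 2 * w.length, σ.mem a = (encode scode pcode w).getD a 0

end PBWT

/-!
The text is rebuilt from its end, one symbol in linear time. Suppose that the suffix `U` of `T` is
known up to renaming, that is, its prev-encoding is known. Each row of the sorted matrix of
rotations gets a *key* relative to `U` (`key`): it tells the position of the first mismatch between
the encoding of the row and that of `U`, which of them is greater, and, if the row is smaller, what
kind of symbol it has there. Keys increase with the rows (`key_mono`), and since the end marker occurs
only once, only the row that starts with `U` itself has the key of equality (`eq_suffixRow`). So the
keys show which row this is, and the pBWT symbol of that row is the symbol to prepend: a static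
symbol, or the rank `a` of the first occurrence of a parameter symbol. In the latter case the symbol
is the one of the `a`-th zero in the encoding of `U` (`getElem_zeroPos`), or a new one if `U` has
fewer zeros (`notMem_of_count_lt`). Hence every parameter symbol can be named by a number that is
either copied or fresh, and these names are a renaming of the symbols of `T` (`exists_renaming`).

It remains to update the keys when `U` becomes `c U`. The rotation that starts one position earlier
than a row is obtained by moving its last symbol, which the pBWT encodes, to its front. Prepending a
static symbol keeps the rest of an encoding. Prepending a parameter symbol changes one zero, the
one whose rank is given by the pBWT, into the distance from the front (`numFrom_inr_cons`), and this
distance is larger than every other number that can stand in its place. Therefore the new key is a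
function of the old key, the two pBWT symbols and the zeros of the encoding of `U` (`key_link`,
`rowKey_succ`). The new keys are obtained in the order of the old rows. As keys are monotone in the
rows and at most linear in `n`, counting sort puts them into the order of the new rows
(`count_count`), and the permutation of the rows itself is never needed.

The algorithm is written in a small language of arrays and counted loops, `inversionProg`. Its
programs are verified by weakest preconditions (`Cmd.wp`) and compiled to the word RAM
(`Cmd.exec_code`), where the running time is bounded by the bound on the loops to the power of their
nesting depth (`Cmd.cost_le`), here two.
-/

namespace PBWT

/-! ### A language of arrays and counted loops -/

/-- Expressions over registers, the cells of the input area and sixteen arrays. The last two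
constructors are conditional expressions: `ifLt a b e f` is `e` if `a < b` and `f` otherwise. -/
inductive Exp where
  | reg (r : ℕ) : Exp
  | imm (k : ℕ) : Exp
  | add (a b : Exp) : Exp
  | sub (a b : Exp) : Exp
  | arr (c : ℕ) (x : Exp) : Exp
  | cell (x : Exp) : Exp
  | ifLt (a b e f : Exp) : Exp
  | ifEq (a b e f : Exp) : Exp

/-- Commands. `loop r b p` runs `p` with register `r` set to `0, 1, …` below the initial value
of `b`. -/
inductive Cmd where
  | set (r : ℕ) (e : Exp) : Cmd
  | store (c : ℕ) (x e : Exp) : Cmd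
  | put (x e : Exp) : Cmd
  | seq (p q : Cmd) : Cmd
  | loop (r : ℕ) (b : Exp) (p : Cmd) : Cmd

/-- The states of the array language: registers, input cells, arrays. -/
structure St where
  reg : ℕ → ℕ
  cell : ℕ → ℕ
  arr : ℕ → ℕ → ℕ

/-- Writing a register. -/
def St.setR (s : St) (r v : ℕ) : St :=
  { s with reg := fun r' => if r' = r then v else s.reg r' }

/-- Writing an input cell. -/
def St.setC (s : St) (x v : ℕ) : St :=
  { s with cell := fun x' => if x' = x then v else s.cell x' }

/-- Writing an entry of an array. -/
def St.setA (s : St) (c x v : ℕ) : St :=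
  { s with arr := fun c' x' => if c' = c ∧ x' = x then v else s.arr c' x' }

@[simp] theorem St.setR_reg (s : St) (r v r' : ℕ) :
    (s.setR r v).reg r' = if r' = r then v else s.reg r' := rfl
@[simp] theorem St.setR_cell (s : St) (r v : ℕ) : (s.setR r v).cell = s.cell := rfl
@[simp] theorem St.setR_arr (s : St) (r v : ℕ) : (s.setR r v).arr = s.arr := rfl
@[simp] theorem St.setC_reg (s : St) (r v : ℕ) : (s.setC r v).reg = s.reg := rfl
@[simp] theorem St.setC_cell (s : St) (x v x' : ℕ) :
    (s.setC x v).cell x' = if x' = x then v else s.cell x' := rfl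
@[simp] theorem St.setC_arr (s : St) (r v : ℕ) : (s.setC r v).arr = s.arr := rfl
@[simp] theorem St.setA_reg (s : St) (c r v : ℕ) : (s.setA c r v).reg = s.reg := rfl
@[simp] theorem St.setA_arr (s : St) (c x v c' x' : ℕ) :
    (s.setA c x v).arr c' x' = if c' = c ∧ x' = x then v else s.arr c' x' := rfl

/-- The value of an expression. -/
@[simp] def Exp.val (s : St) : Exp → ℕ
  | .reg r => s.reg r
  | .imm k => k
  | .add a b => a.val s + b.val s
  | .sub a b => a.val s - b.val s
  | .arr c x => s.arr c (x.val s)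
  | .cell x => s.cell (x.val s)
  | .ifLt a b e f => if a.val s < b.val s then e.val s else f.val s
  | .ifEq a b e f => if a.val s = b.val s then e.val s else f.val s

/-- The evaluation of an expression produces only words below `B`, and reads only input cells
below `2 * n` and array entries with indices below `N`. -/
@[simp] def Exp.Ok (B n N : ℕ) (s : St) : Exp → Prop
  | .reg _ => True
  | .imm k => k < B
  | .add a b => a.Ok B n N s ∧ b.Ok B n N s ∧ a.val s + b.val s < B
  | .sub a b => a.Ok B n N s ∧ b.Ok B n N s
  | .arr c x => c < 16 ∧ x.Ok B n N s ∧ x.val s < N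
  | .cell x => x.Ok B n N s ∧ x.val s < 2 * n
  | .ifLt a b e f => a.Ok B n N s ∧ b.Ok B n N s ∧
      (a.val s < b.val s → e.Ok B n N s) ∧ (¬ a.val s < b.val s → f.Ok B n N s)
  | .ifEq a b e f => a.Ok B n N s ∧ b.Ok B n N s ∧
      (a.val s = b.val s → e.Ok B n N s) ∧ (¬ a.val s = b.val s → f.Ok B n N s)

/-- A sufficient precondition for the safe execution of a command to end in `Q`. Loops are
handled by invariants, and run at most `N` times. -/
def Cmd.wp (B n N : ℕ) : Cmd → (St → Prop) → St → Prop
  | .set r e, Q, s => e.Ok B n N s ∧ Q (s.setR r (e.val s))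
  | .store c x e, Q, s => c < 16 ∧ x.Ok B n N s ∧ x.val s < N ∧ e.Ok B n N s ∧
      Q (s.setA c (x.val s) (e.val s))
  | .put x e, Q, s => x.Ok B n N s ∧ x.val s < 2 * n ∧ e.Ok B n N s ∧
      Q (s.setC (x.val s) (e.val s))
  | .seq p q, Q, s => p.wp B n N (q.wp B n N Q) s
  | .loop r b p, Q, s => b.Ok B n N s ∧ b.val s ≤ N ∧ ∃ I : ℕ → St → Prop, I 0 s ∧
      (∀ i < b.val s, ∀ s', I i s' → p.wp B n N (I (i + 1)) (s'.setR r i)) ∧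
      ∀ s', I (b.val s) s' → Q s'

/-! ### Compilation to the word RAM

Register `r` of the array language is register `3 * r` of the machine, the registers `3 * d + 1`
hold intermediate values, register `2` holds `2 * n`, and the other registers `3 * d + 2` hold the
counters and limits of loops. Entry `x` of array `c` is the cell `2 * n + 16 * x + c`. -/

/-- The code that computes an expression into register `3 * d + 1`. -/
def Exp.code : Exp → ℕ → Prog
  | .reg r, d => .set (3 * d + 1) (.reg (3 * r))
  | .imm k, d => .set (3 * d + 1) (.imm k)
  | .add a b, d => .seq (a.code d) (.seq (b.code (d + 1))
      (.add (3 * d + 1) (.reg (3 * d + 1)) (.reg (3 * (d + 1) + 1))))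
  | .sub a b, d => .seq (a.code d) (.seq (b.code (d + 1))
      (.sub (3 * d + 1) (.reg (3 * d + 1)) (.reg (3 * (d + 1) + 1))))
  | .arr c x, d => .seq (x.code d) (.seq (address c d)
      (.load (3 * d + 1) (.reg (3 * d + 1))))
  | .cell x, d => .seq (x.code d) (.load (3 * d + 1) (.reg (3 * d + 1)))
  | .ifLt a b e f, d => .seq (a.code d) (.seq (b.code (d + 1))
      (.ite (.lt (.reg (3 * d + 1)) (.reg (3 * (d + 1) + 1))) (e.code d) (f.code d)))
  | .ifEq a b e f, d => .seq (a.code d) (.seq (b.code (d + 1))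
      (.ite (.eq (.reg (3 * d + 1)) (.reg (3 * (d + 1) + 1))) (e.code d) (f.code d)))
where
  /-- The code that replaces an index of array `c` in register `3 * d + 1` by its address. -/
  address (c d : ℕ) : Prog :=
    let r := 3 * d + 1
    .seq (.add r (.reg r) (.reg r)) (.seq (.add r (.reg r) (.reg r))
      (.seq (.add r (.reg r) (.reg r)) (.seq (.add r (.reg r) (.reg r))
        (.seq (.add r (.reg r) (.imm c)) (.add r (.reg r) (.reg 2))))))

/-- The code of a command inside `d` loops. -/
def Cmd.code : Cmd → ℕ → Prog
  | .set r e, _ => .seq (e.code 0) (.set (3 * r) (.reg 1))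
  | .store c x e, _ => .seq (x.code 0) (.seq (Exp.code.address c 0)
      (.seq (e.code 1) (.store (.reg 1) (.reg 4))))
  | .put x e, _ => .seq (x.code 0) (.seq (e.code 1) (.store (.reg 1) (.reg 4)))
  | .seq p q, d => .seq (p.code d) (q.code d)
  | .loop r b p, d =>
      let h := 3 * (2 * d + 1) + 2
      let m := 3 * (2 * d + 2) + 2
      .seq (.seq (b.code 0) (.set m (.reg 1))) (.seq (.set h (.imm 0))
        (.while (.lt (.reg h) (.reg m))
          (.seq (.set (3 * r) (.reg h)) (.seq (p.code (d + 1))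
            (.add h (.reg h) (.imm 1))))))

/-- A bound on the time taken by the code of an expression. -/
def Exp.cost : Exp → ℕ
  | .reg _ => 1
  | .imm _ => 1
  | .add a b => a.cost + b.cost + 1
  | .sub a b => a.cost + b.cost + 1
  | .arr _ x => x.cost + 7
  | .cell x => x.cost + 1
  | .ifLt a b e f => a.cost + b.cost + e.cost + f.cost + 1
  | .ifEq a b e f => a.cost + b.cost + e.cost + f.cost + 1

/-- A bound on the time taken by the code of a command whose loops run at most `N` times. -/
def Cmd.cost (N : ℕ) : Cmd → ℕ
  | .set _ e => e.cost + 1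
  | .store _ x e => x.cost + e.cost + 7
  | .put x e => x.cost + e.cost + 1
  | .seq p q => p.cost N + q.cost N
  | .loop _ b p => b.cost + 3 + N * (p.cost N + 3)

/-- The nesting depth of loops. -/
def Cmd.depth : Cmd → ℕ
  | .set _ _ => 0
  | .store _ _ _ => 0
  | .put _ _ => 0
  | .seq p q => max p.depth q.depth
  | .loop _ _ p => p.depth + 1

theorem Cmd.cost_le (c : Cmd) {N : ℕ} (hN : 1 ≤ N) : c.cost N ≤ c.cost 1 * N ^ c.depth := by
  induction c with
  | set r e => simp [cost, depth]
  | store c x e => simp [cost, depth]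
  | put x e => simp [cost, depth]
  | seq p q hp hq =>
    have h1 : N ^ p.depth ≤ N ^ max p.depth q.depth := Nat.pow_le_pow_right hN (le_max_left _ _)
    have h2 : N ^ q.depth ≤ N ^ max p.depth q.depth := Nat.pow_le_pow_right hN (le_max_right _ _)
    simp only [cost, depth, add_mul]
    exact add_le_add (hp.trans (Nat.mul_le_mul_left _ h1)) (hq.trans (Nat.mul_le_mul_left _ h2))
  | loop r b p hp =>
    have h0 : 1 ≤ N ^ p.depth := Nat.one_le_pow _ _ hN
    have h1 : 1 ≤ N ^ p.depth * N := Nat.mul_pos h0 hN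
    simp only [cost, depth, pow_succ]
    nlinarith [Nat.mul_le_mul_right N hp, Nat.mul_le_mul_left (b.cost + 3) h1,
      Nat.mul_le_mul_left (3 * N) h0]

/-- The state of the array language that a state of the machine represents. -/
def toSt (n : ℕ) (σ : State) : St where
  reg r := σ.reg (3 * r)
  cell x := if x < 2 * n then σ.mem x else 0
  arr c x := if c < 16 then σ.mem (2 * n + 16 * x + c) else 0

/-- Every register and every cell holds a word, and register `2` holds the base address. -/
structure Sane (B n : ℕ) (σ : State) : Prop where
  reg : ∀ r, σ.reg r < B
  mem : ∀ a, σ.mem a < B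
  base : σ.reg 2 = 2 * n

theorem Sane.setReg {B n : ℕ} {σ : State} (h : Sane B n σ) {r v : ℕ} (hr : r ≠ 2) (hv : v < B) :
    Sane B n (σ.setReg r v) := by
  refine ⟨fun r' => ?_, h.mem, ?_⟩
  · by_cases e : r' = r
    · subst e; simpa [State.setReg] using hv
    · simpa [State.setReg, Function.update_of_ne e] using h.reg r'
  · simpa [State.setReg, Function.update_of_ne (Ne.symm hr)] using h.base

theorem Sane.setMem {B n : ℕ} {σ : State} (h : Sane B n σ) {a v : ℕ} (hv : v < B) :
    Sane B n (σ.setMem a v) := by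
  refine ⟨h.reg, fun a' => ?_, h.base⟩
  by_cases e : a' = a
  · subst e; simpa [State.setMem] using hv
  · simpa [State.setMem, Function.update_of_ne e] using h.mem a'

@[simp] theorem State.setReg_reg (σ : State) (r v r' : ℕ) :
    (σ.setReg r v).reg r' = if r' = r then v else σ.reg r' := by
  simp [State.setReg, Function.update_apply]
@[simp] theorem State.setReg_mem (σ : State) (r v : ℕ) : (σ.setReg r v).mem = σ.mem := rfl
@[simp] theorem State.setMem_reg (σ : State) (a v : ℕ) : (σ.setMem a v).reg = σ.reg := rfl
@[simp] theorem State.setMem_mem (σ : State) (a v a' : ℕ) :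
    (σ.setMem a v).mem a' = if a' = a then v else σ.mem a' := by
  simp [State.setMem, Function.update_apply]

/-- The states that differ from `σ` only in the registers `3 * d' + 1` with `d ≤ d'`. -/
structure Tmp (d : ℕ) (σ σ' : State) : Prop where
  mem : σ'.mem = σ.mem
  reg : ∀ r, (r % 3 ≠ 1 ∨ r < 3 * d + 1) → σ'.reg r = σ.reg r

theorem Tmp.trans {d d' : ℕ} {σ σ' σ'' : State} (hd : d ≤ d') (h : Tmp d σ σ')
    (h' : Tmp d' σ' σ'') : Tmp d σ σ'' :=
  ⟨h'.mem.trans h.mem, fun r hr =>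
    (h'.reg r (hr.imp_right fun h => by omega)).trans (h.reg r hr)⟩

theorem Tmp.setReg (d : ℕ) (σ : State) (v : ℕ) : Tmp d σ (σ.setReg (3 * d + 1) v) :=
  ⟨rfl, fun r hr => by rw [State.setReg_reg, if_neg (by omega)]⟩

theorem Tmp.toSt_eq {d : ℕ} {σ σ' : State} (n : ℕ) (h : Tmp d σ σ') :
    toSt n σ' = toSt n σ := by
  have h1 : ∀ r, σ'.reg (3 * r) = σ.reg (3 * r) := fun r => h.reg _ (by omega)
  simp [toSt, h.mem, h1]

theorem exec_address {M B n N c d : ℕ} {σ : State} (hs : Sane B n σ) (hc : c < 16)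
    (hM : 2 * n + 16 * N ≤ B) (hx : σ.reg (3 * d + 1) < N) :
    ∃ σ', Exec M B (Exp.code.address c d) σ 6 σ' ∧ Tmp d σ σ' ∧ Sane B n σ' ∧
      σ'.reg (3 * d + 1) = 2 * n + 16 * σ.reg (3 * d + 1) + c := by
  set x := σ.reg (3 * d + 1) with hxd
  have hb := hs.base
  refine ⟨_, Exec.seq _ _ _ _ _ 1 _ (Exec.add _ _ _ _ ?_)
    (Exec.seq _ _ _ _ _ 1 _ (Exec.add _ _ _ _ ?_)
    (Exec.seq _ _ _ _ _ 1 _ (Exec.add _ _ _ _ ?_)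
    (Exec.seq _ _ _ _ _ 1 _ (Exec.add _ _ _ _ ?_)
    (Exec.seq _ _ _ _ _ 1 _ (Exec.add _ _ _ _ ?_) (Exec.add _ _ _ _ ?_))))), ?_, ?_, ?_⟩
  any_goals
    simp [Operand.val, ← hxd, hb]
    try omega
  · refine ⟨rfl, fun r hr => ?_⟩
    have : r ≠ 3 * d + 1 := by omega
    simp [this]
  · have h2 : 3 * d + 1 ≠ 2 := by omega
    refine (((((hs.setReg h2 ?_).setReg h2 ?_).setReg h2 ?_).setReg h2 ?_).setReg h2
      ?_).setReg h2 ?_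
    all_goals omega

/-- The code of an expression computes its value and changes only intermediate registers. -/
theorem Exp.exec_code {M B n N : ℕ} (hB : 2 * n + 16 * N ≤ B) (hM : 2 * n + 16 * N ≤ M)
    (e : Exp) : ∀ (d : ℕ) (σ : State), Sane B n σ → e.Ok B n N (toSt n σ) →
    ∃ t σ', Exec M B (e.code d) σ t σ' ∧ t ≤ e.cost ∧ Tmp d σ σ' ∧ Sane B n σ' ∧
      σ'.reg (3 * d + 1) = e.val (toSt n σ) := by
  induction e with
  | reg r =>
    intro d σ hs _
    exact ⟨1, _, Exec.set _ _ _ (hs.reg _), le_rfl, Tmp.setReg _ _ _,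
      hs.setReg (by omega) (hs.reg _), by simp [Operand.val, toSt]⟩
  | imm k =>
    intro d σ hs ho
    exact ⟨1, _, Exec.set _ _ _ ho, le_rfl, Tmp.setReg _ _ _,
      hs.setReg (by omega) ho, by simp [Operand.val]⟩
  | add a b iha ihb =>
    rintro d σ hs ⟨oa, ob, hv⟩
    obtain ⟨t1, σ1, e1, c1, T1, s1, v1⟩ := iha d σ hs oa
    obtain ⟨t2, σ2, e2, c2, T2, s2, v2⟩ := ihb (d + 1) σ1 s1 (by rwa [T1.toSt_eq])
    have k1 : σ2.reg (3 * d + 1) = a.val (toSt n σ) := by rw [T2.reg _ (by omega), v1]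
    rw [T1.toSt_eq] at v2
    have hv' : (Operand.reg (3 * d + 1)).val σ2 + (Operand.reg (3 * (d + 1) + 1)).val σ2 < B := by
      simpa only [Operand.val, k1, v2] using hv
    refine ⟨_, _, Exec.seq _ _ _ _ _ _ _ e1 (Exec.seq _ _ _ _ _ _ _ e2
      (Exec.add _ _ _ _ hv')), ?_, (T1.trans (Nat.le_succ d) T2).trans le_rfl (Tmp.setReg _ _ _),
      s2.setReg (by omega) hv', ?_⟩
    · simp only [cost]; omega
    · simp [Operand.val, k1, v2]
  | sub a b iha ihb =>
    rintro d σ hs ⟨oa, ob⟩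
    obtain ⟨t1, σ1, e1, c1, T1, s1, v1⟩ := iha d σ hs oa
    obtain ⟨t2, σ2, e2, c2, T2, s2, v2⟩ := ihb (d + 1) σ1 s1 (by rwa [T1.toSt_eq])
    have k1 : σ2.reg (3 * d + 1) = a.val (toSt n σ) := by rw [T2.reg _ (by omega), v1]
    rw [T1.toSt_eq] at v2
    have hv' : (Operand.reg (3 * d + 1)).val σ2 - (Operand.reg (3 * (d + 1) + 1)).val σ2 < B :=
      (Nat.sub_le _ _).trans_lt (s2.reg _)
    refine ⟨_, _, Exec.seq _ _ _ _ _ _ _ e1 (Exec.seq _ _ _ _ _ _ _ e2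
      (Exec.sub _ _ _ _ hv')), ?_, (T1.trans (Nat.le_succ d) T2).trans le_rfl (Tmp.setReg _ _ _),
      s2.setReg (by omega) hv', ?_⟩
    · simp only [cost]; omega
    · simp [Operand.val, k1, v2]
  | arr c x ih =>
    rintro d σ hs ⟨hc, ox, hx⟩
    obtain ⟨t1, σ1, e1, c1, T1, s1, v1⟩ := ih d σ hs ox
    obtain ⟨σ2, e2, T2, s2, v2⟩ := exec_address (M := M) s1 hc hB (v1 ▸ hx)
    have ha : (Operand.reg (3 * d + 1)).val σ2 < M := by
      simp only [Operand.val, v2, v1]; omega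
    refine ⟨_, _, Exec.seq _ _ _ _ _ _ _ e1 (Exec.seq _ _ _ _ _ _ _ e2
      (Exec.load _ _ _ ha (s2.mem _))), ?_, (T1.trans le_rfl T2).trans le_rfl (Tmp.setReg _ _ _),
      s2.setReg (by omega) (s2.mem _), ?_⟩
    · simp only [cost]; omega
    · simp [Operand.val, v2, v1, T2.mem, T1.mem, toSt, hc]
  | cell x ih =>
    rintro d σ hs ⟨ox, hx⟩
    obtain ⟨t1, σ1, e1, c1, T1, s1, v1⟩ := ih d σ hs ox
    have ha : (Operand.reg (3 * d + 1)).val σ1 < M := by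
      simp only [Operand.val, v1]; omega
    refine ⟨_, _, Exec.seq _ _ _ _ _ _ _ e1
      (Exec.load _ _ _ ha (s1.mem _)), ?_, T1.trans le_rfl (Tmp.setReg _ _ _),
      s1.setReg (by omega) (s1.mem _), ?_⟩
    · simp only [cost]; omega
    · simp only [State.setReg_reg, if_true, Operand.val, v1, T1.mem, val]
      exact (if_pos hx).symm
  | ifLt a b e f iha ihb ihe ihf =>
    rintro d σ hs ⟨oa, ob, oe, of⟩
    obtain ⟨t1, σ1, e1, c1, T1, s1, v1⟩ := iha d σ hs oa
    obtain ⟨t2, σ2, e2, c2, T2, s2, v2⟩ := ihb (d + 1) σ1 s1 (by rwa [T1.toSt_eq])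
    have k1 : σ2.reg (3 * d + 1) = a.val (toSt n σ) := by rw [T2.reg _ (by omega), v1]
    rw [T1.toSt_eq] at v2
    have T12 := T1.trans (Nat.le_succ d) T2
    by_cases h : a.val (toSt n σ) < b.val (toSt n σ)
    · obtain ⟨t3, σ3, e3, c3, T3, s3, v3⟩ := ihe d σ2 s2 (by rw [T12.toSt_eq]; exact oe h)
      refine ⟨_, _, Exec.seq _ _ _ _ _ _ _ e1 (Exec.seq _ _ _ _ _ _ _ e2
        (Exec.ite_true _ _ _ _ _ _ ?_ e3)), ?_, T12.trans le_rfl T3, s3, ?_⟩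
      · simpa only [Test.holds, Operand.val, k1, v2] using h
      · simp only [cost]; omega
      · simp [v3, T12.toSt_eq, h]
    · obtain ⟨t3, σ3, e3, c3, T3, s3, v3⟩ := ihf d σ2 s2 (by rw [T12.toSt_eq]; exact of h)
      refine ⟨_, _, Exec.seq _ _ _ _ _ _ _ e1 (Exec.seq _ _ _ _ _ _ _ e2
        (Exec.ite_false _ _ _ _ _ _ ?_ e3)), ?_, T12.trans le_rfl T3, s3, ?_⟩
      · simpa only [Test.holds, Operand.val, k1, v2] using h
      · simp only [cost]; omega
      · simp [v3, T12.toSt_eq, h]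
  | ifEq a b e f iha ihb ihe ihf =>
    rintro d σ hs ⟨oa, ob, oe, of⟩
    obtain ⟨t1, σ1, e1, c1, T1, s1, v1⟩ := iha d σ hs oa
    obtain ⟨t2, σ2, e2, c2, T2, s2, v2⟩ := ihb (d + 1) σ1 s1 (by rwa [T1.toSt_eq])
    have k1 : σ2.reg (3 * d + 1) = a.val (toSt n σ) := by rw [T2.reg _ (by omega), v1]
    rw [T1.toSt_eq] at v2
    have T12 := T1.trans (Nat.le_succ d) T2
    by_cases h : a.val (toSt n σ) = b.val (toSt n σ)
    · obtain ⟨t3, σ3, e3, c3, T3, s3, v3⟩ := ihe d σ2 s2 (by rw [T12.toSt_eq]; exact oe h)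
      refine ⟨_, _, Exec.seq _ _ _ _ _ _ _ e1 (Exec.seq _ _ _ _ _ _ _ e2
        (Exec.ite_true _ _ _ _ _ _ ?_ e3)), ?_, T12.trans le_rfl T3, s3, ?_⟩
      · simpa only [Test.holds, Operand.val, k1, v2] using h
      · simp only [cost]; omega
      · simp [v3, T12.toSt_eq, h]
    · obtain ⟨t3, σ3, e3, c3, T3, s3, v3⟩ := ihf d σ2 s2 (by rw [T12.toSt_eq]; exact of h)
      refine ⟨_, _, Exec.seq _ _ _ _ _ _ _ e1 (Exec.seq _ _ _ _ _ _ _ e2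
        (Exec.ite_false _ _ _ _ _ _ ?_ e3)), ?_, T12.trans le_rfl T3, s3, ?_⟩
      · simpa only [Test.holds, Operand.val, k1, v2] using h
      · simp only [cost]; omega
      · simp [v3, T12.toSt_eq, h]

theorem toSt_setReg (n : ℕ) (σ : State) (r v : ℕ) :
    toSt n (σ.setReg (3 * r) v) = (toSt n σ).setR r v := by
  simp only [toSt, St.setR, State.setReg_reg, State.setReg_mem]
  congr 1
  ext r'
  simp

/-- The code of a command establishes every postcondition whose precondition holds. The last
clause says that the counters and limits of the `d` surrounding loops are kept. -/
theorem Cmd.exec_code {M B n N : ℕ} (hB : 2 * n + 16 * N ≤ B) (hM : 2 * n + 16 * N ≤ M)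
    (c : Cmd) : ∀ (d : ℕ) (Q : St → Prop) (σ : State), Sane B n σ →
    c.wp B n N Q (toSt n σ) →
    ∃ t σ', Exec M B (c.code d) σ t σ' ∧ t ≤ c.cost N ∧ Sane B n σ' ∧ Q (toSt n σ') ∧
      ∀ k < 2 * d + 1, σ'.reg (3 * k + 2) = σ.reg (3 * k + 2) := by
  induction c with
  | set r e =>
    rintro d Q σ hs ⟨oe, hQ⟩
    obtain ⟨t1, σ1, e1, c1, T1, s1, v1⟩ := e.exec_code hB hM 0 σ hs oe
    refine ⟨_, _, Exec.seq _ _ _ _ _ _ _ e1 (Exec.set _ _ _ (s1.reg _)), ?_,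
      s1.setReg (by omega) (s1.reg _), ?_, fun k _ => ?_⟩
    · simp only [cost]; omega
    · rw [toSt_setReg, T1.toSt_eq]
      simpa only [Operand.val, ← v1] using hQ
    · rw [State.setReg_reg, if_neg (by omega), T1.reg _ (by omega)]
  | store c x e =>
    rintro d Q σ hs ⟨hc, ox, hx, oe, hQ⟩
    obtain ⟨t1, σ1, e1, c1, T1, s1, v1⟩ := x.exec_code hB hM 0 σ hs ox
    obtain ⟨σ2, e2, T2, s2, v2⟩ := exec_address (M := M) s1 hc hB (v1 ▸ hx)
    have T12 := T1.trans le_rfl T2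
    obtain ⟨t3, σ3, e3, c3, T3, s3, v3⟩ := e.exec_code hB hM 1 σ2 s2 (by rwa [T12.toSt_eq])
    have v2' : σ3.reg 1 = 2 * n + 16 * x.val (toSt n σ) + c := by
      rw [T3.reg _ (by omega), ← v1]; exact v2
    have v3' : σ3.reg 4 = e.val (toSt n σ) := by rw [← T12.toSt_eq]; exact v3
    have ha : (Operand.reg 1).val σ3 < M := by
      simp only [Operand.val, v2']; omega
    have T13 := T12.trans (Nat.zero_le _) T3
    refine ⟨_, _, Exec.seq _ _ _ _ _ _ _ e1 (Exec.seq _ _ _ _ _ _ _ e2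
      (Exec.seq _ _ _ _ _ _ _ e3 (Exec.store _ _ _ ha (s3.reg _)))), ?_,
      s3.setMem (s3.reg _), ?_, fun k _ => ?_⟩
    · simp only [cost]; omega
    · convert hQ using 1
      rw [← T13.toSt_eq n] at v2' v3' ⊢
      simp only [Operand.val, v2', v3', toSt, St.setA, State.setMem_reg, State.setMem_mem]
      congr 1
      · ext a
        split
        · rw [if_neg (by omega)]
        · rfl
      · ext c' x'
        split
        · congr 1
          simp only [eq_iff_iff]
          omega
        · rw [if_neg (by omega)]
    · rw [State.setMem_reg, T13.reg _ (by omega)]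
  | put x e =>
    rintro d Q σ hs ⟨ox, hx, oe, hQ⟩
    obtain ⟨t1, σ1, e1, c1, T1, s1, v1⟩ := x.exec_code hB hM 0 σ hs ox
    obtain ⟨t3, σ3, e3, c3, T3, s3, v3⟩ := e.exec_code hB hM 1 σ1 s1 (by rwa [T1.toSt_eq])
    have v2' : σ3.reg 1 = x.val (toSt n σ) := by
      rw [T3.reg _ (by omega), ← v1]
    have v3' : σ3.reg 4 = e.val (toSt n σ) := by rw [← T1.toSt_eq]; exact v3
    have ha : (Operand.reg 1).val σ3 < M := by
      simp only [Operand.val, v2']; omega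
    have T13 := T1.trans (Nat.zero_le _) T3
    refine ⟨_, _, Exec.seq _ _ _ _ _ _ _ e1
      (Exec.seq _ _ _ _ _ _ _ e3 (Exec.store _ _ _ ha (s3.reg _))), ?_,
      s3.setMem (s3.reg _), ?_, fun k _ => ?_⟩
    · simp only [cost]; omega
    · convert hQ using 1
      rw [← T13.toSt_eq n] at v2' v3' hx ⊢
      simp only [Operand.val, v2', v3', toSt, St.setC, State.setMem_reg, State.setMem_mem]
      simp only [toSt] at hx
      congr 1
      · ext a
        split
        · rfl
        · rw [if_neg (by omega)]
      · ext c' x'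
        split
        · rw [if_neg (by omega)]
        · rfl
    · rw [State.setMem_reg, T13.reg _ (by omega)]
  | seq p q ihp ihq =>
    rintro d Q σ hs h
    obtain ⟨t1, σ1, e1, c1, s1, h1, f1⟩ := ihp d _ σ hs h
    obtain ⟨t2, σ2, e2, c2, s2, h2, f2⟩ := ihq d _ σ1 s1 h1
    exact ⟨_, _, Exec.seq _ _ _ _ _ _ _ e1 e2, by simp only [cost]; omega, s2, h2,
      fun k hk => (f2 k hk).trans (f1 k hk)⟩
  | loop r b p ih =>
    rintro d Q σ hs ⟨ob, hb, I, h0, hI, hQ⟩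
    obtain ⟨t1, σ1, e1, c1, T1, s1, v1⟩ := b.exec_code hB hM 0 σ hs ob
    have v1' : σ1.reg 1 = b.val (toSt n σ) := v1
    set m := b.val (toSt n σ) with hm
    -- Downward induction on the value of the counter.
    have main : ∀ k i, i + k = m → ∀ σ', Sane B n σ' → I i (toSt n σ') →
        σ'.reg (3 * (2 * d + 1) + 2) = i → σ'.reg (3 * (2 * d + 2) + 2) = m →
        ∃ t σ'', Exec M B (.while (.lt (.reg (3 * (2 * d + 1) + 2)) (.reg (3 * (2 * d + 2) + 2)))
          (.seq (.set (3 * r) (.reg (3 * (2 * d + 1) + 2))) (.seq (p.code (d + 1))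
            (.add (3 * (2 * d + 1) + 2) (.reg (3 * (2 * d + 1) + 2)) (.imm 1))))) σ' t σ'' ∧
          t ≤ 1 + k * (p.cost N + 3) ∧ Sane B n σ'' ∧ I m (toSt n σ'') ∧
          ∀ k < 2 * d + 1, σ''.reg (3 * k + 2) = σ'.reg (3 * k + 2) := by
      intro k
      induction k with
      | zero =>
        intro i hi σ' s' hI' r1 r2
        refine ⟨_, _, Exec.while_false _ _ _ ?_, by omega, s', ?_, fun _ _ => rfl⟩
        · simp only [Test.holds, Operand.val, r1, r2]; omega
        · obtain rfl : i = m := by omega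
          exact hI'
      | succ k ihk =>
        intro i hi σ' s' hI' r1 r2
        have s2 : Sane B n (σ'.setReg (3 * r) i) := s'.setReg (by omega) (r1 ▸ s'.reg _)
        obtain ⟨t3, σ3, e3, c3, s3, h3, f3⟩ := ih (d + 1) (I (i + 1)) (σ'.setReg (3 * r) i) s2
          (by rw [toSt_setReg]; exact hI i (by omega) _ hI')
        have g1 : σ3.reg (3 * (2 * d + 1) + 2) = i := by
          rw [f3 _ (by omega), State.setReg_reg, if_neg (by omega), r1]
        have g2 : σ3.reg (3 * (2 * d + 2) + 2) = m := by
          rw [f3 _ (by omega), State.setReg_reg, if_neg (by omega), r2]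
        have hlt : i + 1 < B := by
          have := s3.reg (3 * (2 * d + 2) + 2); omega
        have A4 : toSt n (σ3.setReg (3 * (2 * d + 1) + 2) (i + 1)) = toSt n σ3 := by
          have : ∀ r, ¬ (3 * r = 3 * (2 * d + 1) + 2) := by omega
          simp [toSt, this]
        obtain ⟨t5, σ5, e5, c5, s5, h5, f5⟩ := ihk (i + 1) (by omega)
          (σ3.setReg (3 * (2 * d + 1) + 2) (i + 1)) (s3.setReg (by omega) hlt)
          (by rw [A4]; exact h3) (by simp) (by
            rw [State.setReg_reg, if_neg (by omega), g2])
        have E2 := Exec.set (M := M) (B := B) σ' (3 * r) (.reg (3 * (2 * d + 1) + 2)) (s'.reg _)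
        have E4 := Exec.add (M := M) (B := B) σ3 (3 * (2 * d + 1) + 2)
          (.reg (3 * (2 * d + 1) + 2)) (.imm 1) (by simpa only [Operand.val, g1] using hlt)
        simp only [Operand.val, r1] at E2
        simp only [Operand.val, g1] at E4
        refine ⟨_, _, Exec.while_true _ _ _ _ _ _ _ ?_ (Exec.seq _ _ _ _ _ _ _ E2
          (Exec.seq _ _ _ _ _ _ _ e3 E4)) e5, ?_, s5, h5, fun k hk => ?_⟩
        · simp only [Test.holds, Operand.val, r1, r2]; omega
        · have : (k + 1) * (p.cost N + 3) = k * (p.cost N + 3) + p.cost N + 3 := by ring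
          omega
        · rw [f5 k hk, State.setReg_reg, if_neg (by omega), f3 k (by omega), State.setReg_reg,
            if_neg (by omega)]
    set σ2 := (σ1.setReg (3 * (2 * d + 2) + 2) m).setReg (3 * (2 * d + 1) + 2) 0 with hσ2
    have hm' : m < B := v1' ▸ s1.reg 1
    have A2 : toSt n σ2 = toSt n σ := by
      rw [← T1.toSt_eq]
      have : ∀ k r, ¬ (3 * r = 3 * k + 2) := by omega
      simp [toSt, hσ2, this]
    obtain ⟨t5, σ5, e5, c5, s5, h5, f5⟩ := main m 0 (by omega) σ2
      ((s1.setReg (by omega) hm').setReg (by omega) (by omega)) (by rw [A2]; exact h0)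
      (by simp [hσ2]) (by rw [hσ2, State.setReg_reg, if_neg (by omega)]; simp)
    have E1 := Exec.set (M := M) (B := B) σ1 (3 * (2 * d + 2) + 2) (.reg 1) (s1.reg _)
    have E2 := Exec.set (M := M) (B := B) (σ1.setReg (3 * (2 * d + 2) + 2) m)
      (3 * (2 * d + 1) + 2) (.imm 0) (by simp only [Operand.val]; omega)
    simp only [Operand.val, v1'] at E1 E2
    refine ⟨_, _, Exec.seq _ _ _ _ _ _ _ (Exec.seq _ _ _ _ _ _ _ e1 E1)
      (Exec.seq _ _ _ _ _ _ _ E2 e5), ?_, s5, hQ _ h5, fun k hk => ?_⟩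
    · have : m * (p.cost N + 3) ≤ N * (p.cost N + 3) := Nat.mul_le_mul_right _ hb
      simp only [cost]; omega
    · rw [f5 k hk, hσ2, State.setReg_reg, if_neg (by omega), State.setReg_reg,
        if_neg (by omega), T1.reg _ (by omega)]

/-! ### Positions of rows relative to a prefix -/

/-- The key of the string `Y` relative to the string `X`, both starting at position `l`, where
`B` is the symbol `0`, smaller numbers are static symbols and larger ones distances. The keys are
`H` if `X` is a prefix of `Y`, and `2 * H - 2 * i` if `Y` is greater at the first mismatch `i`.
If `Y` is smaller there, the key is `2 * i`, `2 * i + 1` or `2 * i + 2` for a static symbol, a `0`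
or a distance in `Y`. -/
def key (B H : ℕ) : ℕ → List ℕ → List ℕ → ℕ
  | _, [], _ => H
  | _, _ :: _, [] => H
  | l, x :: X, y :: Y =>
    if y = x then key B H (l + 1) X Y else if x < y then 2 * H - 2 * l
    else if y < B then 2 * l else if y = B then 2 * l + 1 else 2 * l + 2

/-- Replaces the `a`-th symbol `0` of a string that starts at position `l`, if there is one, by
the distance from a parameter symbol prepended at position `-1`. -/
def link (B : ℕ) : ℕ → ℕ → List ℕ → List ℕ
  | _, _, [] => []
  | 0, _, X => X
  | a + 1, l, x :: X =>
    if x = B then if a = 0 then (B + l + 1) :: X else x :: link B a (l + 1) X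
    else x :: link B (a + 1) (l + 1) X

/-- The position of the `a`-th symbol `0` of a string that starts at position `l`, or the position
after the string if there is none. -/
def zeroPos (B : ℕ) : ℕ → List ℕ → ℕ → ℕ
  | l, [], _ => l
  | l, x :: X, a =>
    if x = B then if a ≤ 1 then l else zeroPos B (l + 1) X (a - 1) else zeroPos B (l + 1) X a

/-- Distances do not point beyond position `-1`, when the string starts at position `l`. -/
def Bounded (B : ℕ) : ℕ → List ℕ → Prop
  | _, [] => True
  | l, x :: X => x ≤ B + l ∧ Bounded B (l + 1) X

theorem zeroPos_count (B : ℕ) : ∀ (X : List ℕ) (l i : ℕ), X[i]? = some B →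
    zeroPos B l X ((X.take i).count B + 1) = l + i := by
  intro X
  induction X with
  | nil => simp
  | cons x X ih =>
    intro l i h
    cases i with
    | zero =>
      obtain rfl : x = B := by simpa using h
      simp [zeroPos]
    | succ i =>
      have := ih (l + 1) i (by simpa using h)
      by_cases hx : x = B
      · subst hx
        simp [zeroPos, this]; omega
      · simp [zeroPos, this, hx]; omega

/-- The effect on a key of lengthening the common prefix by one. -/
def shiftKey (H k : ℕ) : ℕ := if k < H then k + 2 else if H < k then k - 2 else k

/-- The position of the mismatch that a key tells. -/
def keyPos (H k : ℕ) : ℕ := if k < H then k / 2 else (2 * H - k) / 2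

/-- The number of symbols `0` before the mismatch that a key tells. -/
def keyZeros (B H l : ℕ) (X : List ℕ) (k : ℕ) : ℕ :=
  if k = H then 0 else (X.take (keyPos H k - l)).count B

/-- Which string has a `0` where the other has a distance, at the mismatch that a key tells:
`1` for the one whose key it is, `2` for the reference string `X`, `0` for none. -/
def keyFlag (B H l : ℕ) (X : List ℕ) (k : ℕ) : ℕ :=
  if k < H then k % 2 else if H < k ∧ X.getD (keyPos H k - l) (B + 1) = B then 2 else 0

/-- The new key after prepending parameter symbols: `a` and `b` are the ranks of their first
occurrences in `X` and in the string with key `k`, and `pa`, `pb` the positions of the zeros of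
these ranks in `X`. In the first two cases one of the strings gets a distance where both had a
`0` before their mismatch. In the next two a `0` at the mismatch becomes a distance. -/
def nextKey (H a b z f k pa pb : ℕ) : ℕ :=
  if b < a ∧ b ≤ z then 2 * H - (2 * pb + 2) else if a < b ∧ a ≤ z then 2 * pa + 3
  else if f = 1 ∧ b = z + 1 then 2 * H - 1 - k else if f = 2 ∧ a = z + 1 then 2 * H + 4 - k
  else shiftKey H k

theorem key_bounds (B H : ℕ) : ∀ (X Y : List ℕ) (l : ℕ), 2 * (l + X.length) ≤ H →
    2 * l ≤ key B H l X Y ∧ key B H l X Y ≤ 2 * H - 2 * l ∧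
      (key B H l X Y < H → key B H l X Y ≤ 2 * (l + X.length)) ∧
      (H < key B H l X Y → key B H l X Y % 2 = 0 ∧
        2 * H + 2 ≤ key B H l X Y + 2 * (l + X.length)) := by
  intro X
  induction X with
  | nil => intro Y l h; simp only [List.length_nil, key] at *; omega
  | cons x X ih =>
    intro Y l h
    cases Y with
    | nil => simp only [List.length_cons, key] at *; omega
    | cons y Y =>
      simp only [List.length_cons] at h
      have := ih Y (l + 1) (by omega)
      simp only [key, List.length_cons]
      split_ifs <;> omega

/-- Keys grow with the lexicographic order. -/
theorem key_mono (B H : ℕ) : ∀ (X Y Y' : List ℕ) (l : ℕ), 2 * (l + X.length) ≤ H →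
    X.length ≤ Y.length → X.length ≤ Y'.length →
    ¬ List.Lex (· < ·) Y' Y → key B H l X Y ≤ key B H l X Y' := by
  intro X
  induction X with
  | nil => intros; simp [key]
  | cons x X ih =>
    intro Y Y' l h hY hY' hle
    cases Y with
    | nil => simp at hY
    | cons y Y =>
    cases Y' with
    | nil => simp at hY'
    | cons y' Y' =>
      simp only [List.length_cons] at h hY hY'
      have b1 := key_bounds B H X Y (l + 1) (by omega)
      have b2 := key_bounds B H X Y' (l + 1) (by omega)
      rw [List.cons_lex_cons_iff, not_or, not_and] at hle
      rcases lt_or_eq_of_le (not_lt.mp hle.1) with hlt | rfl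
      · simp only [key]
        split_ifs <;> omega
      · have hle := hle.2 rfl
        have := ih Y Y' (l + 1) (by omega) (by omega) (by omega) hle
        simp only [key]
        split_ifs <;> omega

theorem key_take (B H : ℕ) : ∀ (X Y : List ℕ) (l m : ℕ), X.length ≤ m →
    key B H l X (Y.take m) = key B H l X Y := by
  intro X
  induction X with
  | nil => intros; simp [key]
  | cons x X ih =>
    intro Y l m hm
    obtain ⟨m, rfl⟩ : ∃ k, m = k + 1 := ⟨m - 1, by simp at hm; omega⟩
    cases Y with
    | nil => simp
    | cons y Y => simp [key, ih Y (l + 1) m (by simpa using hm)]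

theorem key_succ (B H : ℕ) : ∀ (X Y : List ℕ) (l : ℕ), 2 * (l + X.length) < H →
    key B H (l + 1) X Y = shiftKey H (key B H l X Y) := by
  intro X
  induction X with
  | nil => intro Y l h; simp [key, shiftKey]
  | cons x X ih =>
    intro Y l h
    cases Y with
    | nil => simp [key, shiftKey]
    | cons y Y =>
      simp only [List.length_cons] at h
      have := ih Y (l + 1) (by omega)
      simp only [key]
      split_ifs
      · exact this
      all_goals
        simp only [shiftKey]
        split_ifs <;> omega

theorem le_zeroPos (B : ℕ) (X : List ℕ) : ∀ l a, l ≤ zeroPos B l X a := by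
  induction X with
  | nil => exact fun l _ => le_rfl
  | cons x X ih =>
    intro l a
    simp only [zeroPos]
    split_ifs
    · exact le_rfl
    · exact (Nat.le_succ l).trans (ih _ _)
    · exact (Nat.le_succ l).trans (ih _ _)

theorem zeroPos_lt (B : ℕ) : ∀ (X : List ℕ) (l a : ℕ), 1 ≤ a → a ≤ X.count B →
    zeroPos B l X a < l + X.length := by
  intro X
  induction X with
  | nil => intro l a h1 h2; simp at h2; omega
  | cons x X ih =>
    intro l a h1 h2
    simp only [zeroPos, List.length_cons]
    split_ifs with hx ha
    · omega
    · subst hx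
      have := ih (l + 1) (a - 1) (by omega) (by rw [List.count_cons_self] at h2; omega)
      omega
    · have := ih (l + 1) a h1 (by simpa [List.count_cons, hx] using h2)
      omega

theorem link_cons (B a l x : ℕ) (X : List ℕ) :
    ∃ X', link B (a + 1) l (x :: X) = (if x = B ∧ a = 0 then B + l + 1 else x) :: X' := by
  simp only [link]
  split_ifs <;> simp_all

theorem nextKey_succ (H a b z f k pa pb : ℕ) :
    nextKey H (a + 1) (b + 1) (z + 1) f k pa pb = nextKey H a b z f k pa pb := by
  simp [nextKey]

theorem nextKey_zeros (H a b f k pa pb : ℕ) :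
    nextKey H (a + 1) (b + 1) 0 f k pa pb = if f = 1 ∧ b = 0 then 2 * H - 1 - k
      else if f = 2 ∧ a = 0 then 2 * H + 4 - k else shiftKey H k := by
  simp [nextKey]

/-- The key after prepending parameter symbols to both strings can be computed from the old key
and from `X`: a `0` that becomes a distance in one string only creates a new mismatch, or resolves
a mismatch between a `0` and a distance in the opposite sense, as the new distance is the largest
possible. -/
theorem key_link (B H : ℕ) : ∀ (X Y : List ℕ) (l a b : ℕ), X.length ≤ Y.length →
    2 * (l + X.length) < H → 1 ≤ a → 1 ≤ b → Bounded B l X → Bounded B l Y →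
    (key B H l X Y = H → a = b) →
    key B H (l + 1) (link B a l X) (link B b l Y) =
      nextKey H a b (keyZeros B H l X (key B H l X Y)) (keyFlag B H l X (key B H l X Y))
        (key B H l X Y) (zeroPos B l X a) (zeroPos B l X b) := by
  intro X
  induction X with
  | nil =>
    intro Y l a b _ _ _ _ _ _ hab
    obtain rfl := hab rfl
    simp [link, key, nextKey, keyFlag, shiftKey]
  | cons x X ih =>
    intro Y l a b hXY hH ha hb hX hY hab
    cases Y with
    | nil => simp at hXY
    | cons y Y =>
    obtain ⟨a, rfl⟩ : ∃ k, a = k + 1 := ⟨a - 1, by omega⟩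
    obtain ⟨b, rfl⟩ : ∃ k, b = k + 1 := ⟨b - 1, by omega⟩
    simp only [List.length_cons] at hH hXY
    obtain ⟨hx, hX⟩ := hX
    obtain ⟨hy, hY⟩ := hY
    have kb := key_bounds B H X Y (l + 1) (by omega)
    by_cases hyx : y = x
    · subst hyx
      have hk : key B H l (y :: X) (y :: Y) = key B H (l + 1) X Y := by simp [key]
      rw [hk] at hab ⊢
      set k := key B H (l + 1) X Y with hkd
      have hp : k ≠ H → keyPos H k - l = keyPos H k - (l + 1) + 1 := by
        intro hne
        simp only [keyPos]; split_ifs <;> omega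
      have hz : k ≠ H → keyZeros B H l (y :: X) k =
          keyZeros B H (l + 1) X k + if y = B then 1 else 0 := by
        intro hne
        simp only [keyZeros, if_neg hne, hp hne, List.take_succ_cons, List.count_cons, beq_iff_eq]
      have hf : keyFlag B H l (y :: X) k = keyFlag B H (l + 1) X k := by
        by_cases hne : k = H
        · simp [keyFlag, hne]
        · simp only [keyFlag, hp hne, List.getD_cons_succ]
      rw [hf]
      by_cases hyB : y = B
      · subst hyB
        simp only [if_true] at hz
        have hf0 : k = H → keyFlag y H (l + 1) X k = 0 := by
          rintro h; simp [keyFlag, h]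
        by_cases h0 : a = 0 <;> by_cases h1 : b = 0
        · subst h0 h1
          have := key_succ y H X Y (l + 1) (by omega)
          simp only [link, if_true, key, this, ← hkd, nextKey]
          by_cases hne : k = H
          · simp [hf0 hne]
          · simp [hz hne]
        · subst h0
          have hne : k ≠ H := fun h => h1 (by have := hab h; omega)
          simp only [link, if_true, key, if_neg h1, zeroPos, nextKey, hz hne]
          split_ifs <;> omega
        · subst h1
          have hne : k ≠ H := fun h => h0 (by have := hab h; omega)
          simp only [link, if_true, key, if_neg h0, zeroPos, nextKey, hz hne]
          split_ifs <;> omega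
        · have := ih Y (l + 1) a b (by omega) (by omega) (by omega) (by omega) hX hY
            (fun h => by have := hab h; omega)
          simp only [link, if_true, key, if_neg h0, if_neg h1, this, ← hkd]
          have za : zeroPos y l (y :: X) (a + 1) = zeroPos y (l + 1) X a := by
            simp [zeroPos, h0]
          have zb : zeroPos y l (y :: X) (b + 1) = zeroPos y (l + 1) X b := by
            simp [zeroPos, h1]
          rw [za, zb]
          by_cases hne : k = H
          · obtain rfl : a = b := by have := hab hne; omega
            simp [nextKey, hf0 hne]
          · rw [hz hne, nextKey_succ]
      · simp only [if_neg hyB, add_zero] at hz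
        have hz' : keyZeros B H l (y :: X) k = keyZeros B H (l + 1) X k := by
          by_cases hne : k = H
          · simp [keyZeros, hne]
          · exact hz hne
        have := ih Y (l + 1) (a + 1) (b + 1) (by omega) (by omega) ha hb hX hY hab
        simp only [link, if_neg hyB, key, if_true, this, ← hkd, hz', zeroPos]
    · have hz : keyZeros B H l (x :: X) (key B H l (x :: X) (y :: Y)) = 0 := by
        simp only [keyZeros, ite_eq_left_iff]
        intro _
        simp only [key, if_neg hyx, keyPos]
        by_cases hxB : x = B
        · have : ∀ k, k = 0 → ((x :: X).take k).count B = 0 := by rintro _ rfl; simp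
          apply this
          split_ifs <;> omega
        · have : ∀ k, k ≤ 1 → ((x :: X).take k).count B = 0 := by
            intro k hk
            interval_cases k <;> simp [hxB]
          apply this
          split_ifs <;> omega
      have hf : keyFlag B H l (x :: X) (key B H l (x :: X) (y :: Y)) =
          if x < y then (if x = B then 2 else 0) else if y = B then 1 else 0 := by
        simp only [key, if_neg hyx]
        by_cases hxy : x < y
        · have h1 : ¬ 2 * H - 2 * l < H := by omega
          have h2 : H < 2 * H - 2 * l := by omega
          have h3 : (2 * H - (2 * H - 2 * l)) / 2 - l = 0 := by omega
          simp [keyFlag, keyPos, hxy, h1, h2, h3]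
        · simp only [hxy, if_false, keyFlag]
          split_ifs <;> omega
      rw [hz, hf]
      obtain ⟨X', hX'⟩ := link_cons B a l x X
      obtain ⟨Y', hY'⟩ := link_cons B b l y Y
      rw [hX', hY', nextKey_zeros]
      clear hX' hY' ih kb hab hf hz
      rcases lt_or_gt_of_ne hyx with hlt | hlt
      · have h1 : ¬ (y = B ∧ b = 0 ∧ x = B ∧ a = 0) := by omega
        have h2 : ¬ x < y := by omega
        have hx0 : x ≠ B ∨ y < B := by omega
        simp only [key, if_neg hyx, if_neg h2]
        rcases lt_trichotomy y B with hyB | hyB | hyB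
        · have h3 : ¬ y = B := by omega
          have h4 : y < B + l + 1 := by omega
          have h5 : shiftKey H (2 * l) = 2 * l + 2 := by
            simp only [shiftKey]; split_ifs <;> omega
          simp only [hyB, h3, if_true, if_false, false_and, OfNat.zero_ne_ofNat, h5,
            Nat.zero_ne_one]
          split_ifs <;> omega
        · have h3 : ¬ y < B := by omega
          have h4 : ¬ x = B := by omega
          have h5 : shiftKey H (2 * l + 1) = 2 * l + 3 := by
            simp only [shiftKey]; split_ifs <;> omega
          simp only [hyB, h4, if_true, if_false, false_and, true_and]
          split_ifs <;> omega
        · have h3 : ¬ y < B := by omega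
          have h4 : ¬ x = B := by omega
          have h6 : ¬ y = B := by omega
          have h5 : shiftKey H (2 * l + 2) = 2 * l + 4 := by
            simp only [shiftKey]; split_ifs <;> omega
          simp only [h3, h6, h4, if_false, false_and, OfNat.zero_ne_ofNat, h5, Nat.zero_ne_one]
          split_ifs
          omega
      · have h5 : shiftKey H (2 * H - 2 * l) = 2 * H - 2 * l - 2 := by
          simp only [shiftKey]; split_ifs <;> omega
        simp only [key, if_neg hyx, if_pos hlt, h5]
        by_cases hxB : x = B
        · have h6 : ¬ y = B := by omega
          simp only [hxB, h6, if_true, if_false, false_and, true_and, OfNat.ofNat_ne_one]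
          split_ifs <;> omega
        · simp only [hxB, if_false, false_and, OfNat.zero_ne_ofNat, Nat.zero_ne_one]
          split_ifs <;> omega

section
variable {S P : Type*} [DecidableEq S] [DecidableEq P]

/-! ### Prev-encodings in context -/

/-- The prev-encoding of `v` as the continuation of `u`. -/
def prevFrom (u : List (S ⊕ P)) : List (S ⊕ P) → List (S ⊕ ℕ)
  | [] => []
  | d :: v => prevSymbol u d :: prevFrom (u ++ [d]) v

@[simp] theorem length_prevFrom (u v : List (S ⊕ P)) : (prevFrom u v).length = v.length := by
  induction v generalizing u with
  | nil => rfl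
  | cons d v ih => simp [prevFrom, ih]

theorem getElem_prevFrom (u v : List (S ⊕ P)) (i : ℕ) (h : i < (prevFrom u v).length) :
    (prevFrom u v)[i] = prevSymbol (u ++ v.take i) (v[i]'(by simpa using h)) := by
  induction v generalizing u i with
  | nil => simp [prevFrom] at h
  | cons d v ih =>
    cases i with
    | zero => simp [prevFrom]
    | succ i => simp [prevFrom, ih]

theorem prevEnc_eq (v : List (S ⊕ P)) : prevEnc v = prevFrom [] v := by
  refine List.ext_getElem (by simp [prevEnc]) fun i h1 h2 => ?_
  simp [getElem_prevFrom, prevEnc]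

theorem prevFrom_append (u v w : List (S ⊕ P)) :
    prevFrom u (v ++ w) = prevFrom u v ++ prevFrom (u ++ v) w := by
  induction v generalizing u with
  | nil => simp [prevFrom]
  | cons d v ih => simp [prevFrom, ih]

theorem prevSymbol_of_notMem {u : List (S ⊕ P)} {p : P} (h : Sum.inr p ∉ u) :
    prevSymbol u (Sum.inr p) = Sum.inr 0 := by
  have : u.reverse.findIdx? (fun x => decide (x = Sum.inr p)) = none := by
    rw [List.findIdx?_eq_none_iff]
    intro x hx
    simp only [decide_eq_false_iff_not]
    rintro rfl
    exact h (List.mem_reverse.mp hx)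
  simp [prevSymbol, this]

theorem prevSymbol_of_mem {u : List (S ⊕ P)} {p : P} (h : Sum.inr p ∈ u) :
    ∃ k, prevSymbol u (Sum.inr p) = Sum.inr (k + 1) ∧ k + 1 ≤ u.length ∧
      u.reverse.findIdx? (fun x => decide (x = Sum.inr p)) = some k := by
  cases hk : u.reverse.findIdx? (fun x => decide (x = Sum.inr p)) with
  | none =>
    rw [List.findIdx?_eq_none_iff] at hk
    simpa using hk _ (List.mem_reverse.mpr h)
  | some k =>
    refine ⟨k, by simp [prevSymbol, hk], ?_, rfl⟩
    rw [List.findIdx?_eq_some_iff_getElem] at hk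
    obtain ⟨h, -⟩ := hk
    simpa using h

theorem prevSymbol_cons_of_ne {u : List (S ⊕ P)} {c d : S ⊕ P} (h : c ≠ d) :
    prevSymbol (c :: u) d = prevSymbol u d := by
  cases d with
  | inl s => rfl
  | inr p =>
    simp only [prevSymbol, List.reverse_cons, List.findIdx?_append]
    cases u.reverse.findIdx? (fun x => decide (x = Sum.inr p)) <;>
      simp [List.findIdx?_cons, h]

theorem prevSymbol_cons_of_mem {u : List (S ⊕ P)} {p : P} (h : Sum.inr p ∈ u) (c : S ⊕ P) :
    prevSymbol (c :: u) (Sum.inr p) = prevSymbol u (Sum.inr p) := by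
  obtain ⟨k, -, -, hk⟩ := prevSymbol_of_mem h
  simp [prevSymbol, List.reverse_cons, List.findIdx?_append, hk]

theorem prevSymbol_cons_self {u : List (S ⊕ P)} {p : P} (h : Sum.inr p ∉ u) :
    prevSymbol (Sum.inr p :: u) (Sum.inr p) = Sum.inr (u.length + 1) := by
  have : u.reverse.findIdx? (fun x => decide (x = Sum.inr p)) = none := by
    rw [List.findIdx?_eq_none_iff]
    intro x hx
    simp only [decide_eq_false_iff_not]
    rintro rfl
    exact h (List.mem_reverse.mp hx)
  simp [prevSymbol, List.reverse_cons, List.findIdx?_append, this, List.findIdx?_cons]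

theorem prevFrom_inl_cons (s : S) (u v : List (S ⊕ P)) :
    prevFrom (Sum.inl s :: u) v = prevFrom u v := by
  induction v generalizing u with
  | nil => rfl
  | cons d v ih =>
    simp only [prevFrom, List.cons_append, ih]
    congr 1
    cases d with
    | inl => rfl
    | inr q => exact prevSymbol_cons_of_ne (by simp)

theorem prevFrom_inr_cons_of_mem {u : List (S ⊕ P)} {p : P} (h : Sum.inr p ∈ u)
    (v : List (S ⊕ P)) : prevFrom (Sum.inr p :: u) v = prevFrom u v := by
  induction v generalizing u with
  | nil => rfl
  | cons d v ih =>
    simp only [prevFrom, List.cons_append, ih (List.mem_append_left _ h)]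
    congr 1
    by_cases hd : Sum.inr p = d
    · subst hd; exact prevSymbol_cons_of_mem h _
    · exact prevSymbol_cons_of_ne hd

/-- The number of parameter symbols that occur first in `w`, as the continuation of `u`, up to the
first occurrence of `p`. -/
def firstRank (p : P) (u : List (S ⊕ P)) : List (S ⊕ P) → ℕ
  | [] => 1
  | d :: w => if d = Sum.inr p then 1 else
      firstRank p (u ++ [d]) w + if prevSymbol u d = Sum.inr 0 then 1 else 0

theorem firstRank_pos (p : P) (u w : List (S ⊕ P)) : 1 ≤ firstRank p u w := by
  induction w generalizing u with
  | nil => rfl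
  | cons d w ih =>
    simp only [firstRank]
    split
    · rfl
    · exact (ih _).trans (Nat.le_add_right _ _)

theorem zeros_take_findIdx {p : P} {w : List (S ⊕ P)} (hw : Sum.inr p ∈ w) :
    ∀ {u : List (S ⊕ P)}, Sum.inr p ∉ u →
    zeros (prevFrom u (w.take (w.findIdx (fun x => decide (x = Sum.inr p)) + 1))) =
      firstRank p u w := by
  induction w with
  | nil => simp at hw
  | cons d w ih =>
    intro u hu
    by_cases hd : d = Sum.inr p
    · subst hd
      simp [firstRank, zeros, prevFrom, prevSymbol_of_notMem hu, List.findIdx_cons]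
    · have := ih (List.mem_of_ne_of_mem (Ne.symm hd) hw) (u := u ++ [d])
        (by simpa [hu] using Ne.symm hd)
      simp only [zeros] at this
      simp [List.findIdx_cons, hd, prevFrom, zeros, firstRank, this, List.countP_cons]

theorem rotSymbol_append_inr (u : List (S ⊕ P)) (p : P) :
    rotSymbol (u ++ [Sum.inr p]) = Sum.inr (firstRank p [] (u ++ [Sum.inr p])) := by
  simp only [rotSymbol, List.getLast?_concat, prevEnc_eq]
  rw [zeros_take_findIdx (by simp) (by simp)]

theorem rotSymbol_append_inl (u : List (S ⊕ P)) (s : S) :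
    rotSymbol (u ++ [(Sum.inl s : S ⊕ P)]) = Sum.inl s := by
  simp [rotSymbol]

/-! ### Encoded symbols as numbers -/

/-- Static symbols as their codes, integers as the numbers from `B` on. -/
def symCode {S : Type*} (scode : S → ℕ) (B : ℕ) : S ⊕ ℕ → ℕ := Sum.elim scode (B + ·)

/-- The prev-encoding of the continuation `v` of `u` as a string of numbers. -/
def numFrom (scode : S → ℕ) (B : ℕ) (u v : List (S ⊕ P)) : List ℕ :=
  (prevFrom u v).map (symCode scode B)

section
variable {scode : S → ℕ} {B : ℕ}

@[simp] theorem length_numFrom (u v : List (S ⊕ P)) :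
    (numFrom scode B u v).length = v.length := by simp [numFrom]

theorem numFrom_nil (u : List (S ⊕ P)) : numFrom scode B u [] = [] := rfl

theorem numFrom_cons (u v : List (S ⊕ P)) (d : S ⊕ P) :
    numFrom scode B u (d :: v) =
      symCode scode B (prevSymbol u d) :: numFrom scode B (u ++ [d]) v := rfl

theorem symCode_eq {S : Type*} {scode : S → ℕ} {B : ℕ} (hB : ∀ s, scode s < B) (x : S ⊕ ℕ) :
    symCode scode B x = B ↔ x = Sum.inr 0 := by
  cases x with
  | inl s => simp [symCode, (hB s).ne]
  | inr k => simp [symCode]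

theorem bounded_numFrom (hB : ∀ s, scode s < B) (u v : List (S ⊕ P)) :
    Bounded B u.length (numFrom scode B u v) := by
  induction v generalizing u with
  | nil => trivial
  | cons d v ih =>
    refine ⟨?_, by simpa [numFrom] using ih (u ++ [d])⟩
    cases d with
    | inl s => exact (hB s).le.trans (Nat.le_add_right _ _)
    | inr p =>
      by_cases hp : Sum.inr p ∈ u
      · obtain ⟨k, hk, hk', -⟩ := prevSymbol_of_mem hp
        simpa [hk, symCode] using hk'
      · simp [prevSymbol_of_notMem hp, symCode]

/-- Prepending a parameter symbol turns its first occurrence, which is the zero whose rank is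
`firstRank`, into a distance. -/
theorem numFrom_inr_cons (hB : ∀ s, scode s < B) {p : P} (v r : List (S ⊕ P)) :
    ∀ {u : List (S ⊕ P)}, Sum.inr p ∉ u → numFrom scode B (Sum.inr p :: u) v =
      link B (firstRank p u (v ++ r)) u.length (numFrom scode B u v) := by
  induction v with
  | nil => intros; simp [numFrom_nil, link]
  | cons d v ih =>
    intro u hu
    by_cases hd : d = Sum.inr p
    · subst hd
      simp only [List.cons_append, numFrom_cons, firstRank, if_true, link,
        prevSymbol_of_notMem hu, symCode_eq hB, prevSymbol_cons_self hu]
      congr 1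
      simp only [numFrom]
      rw [prevFrom_inr_cons_of_mem (by simp)]
    · have hu' : Sum.inr p ∉ u ++ [d] := by simpa [hu] using Ne.symm hd
      have h1 := ih hu'
      obtain ⟨k, hk⟩ : ∃ k, firstRank p (u ++ [d]) (v ++ r) = k + 1 :=
        ⟨_, (Nat.sub_add_cancel (firstRank_pos _ _ _)).symm⟩
      rw [hk] at h1
      simp only [List.cons_append, numFrom_cons, firstRank, if_neg hd, hk,
        prevSymbol_cons_of_ne (Ne.symm hd)]
      by_cases h0 : prevSymbol u d = Sum.inr 0
      · simp [h0, link, symCode, h1]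
      · simp [h0, link, symCode_eq hB, h1]

/-- The zero whose rank is `firstRank p` stands for an occurrence of `p`. -/
theorem getElem_zeroPos (hB : ∀ s, scode s < B) {p : P} (v r : List (S ⊕ P)) :
    ∀ {u : List (S ⊕ P)}, Sum.inr p ∉ u →
      firstRank p u (v ++ r) ≤ (numFrom scode B u v).count B →
      ∃ i, zeroPos B u.length (numFrom scode B u v) (firstRank p u (v ++ r)) = u.length + i ∧
        v[i]? = some (Sum.inr p) := by
  induction v with
  | nil =>
    intro u _ h
    have := firstRank_pos p u r
    simp [numFrom_nil] at h
    omega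
  | cons d v ih =>
    intro u hu h
    by_cases hd : d = Sum.inr p
    · subst hd
      exact ⟨0, by simp [numFrom_cons, firstRank, zeroPos, prevSymbol_of_notMem hu, symCode], rfl⟩
    · have hu' : Sum.inr p ∉ u ++ [d] := by simpa [hu] using Ne.symm hd
      have hf := firstRank_pos p (u ++ [d]) (v ++ r)
      simp only [List.cons_append, numFrom_cons, firstRank, if_neg hd, List.count_cons,
        beq_iff_eq, symCode_eq hB, Nat.add_le_add_iff_right] at h
      obtain ⟨i, h1, h2⟩ := ih hu' h
      refine ⟨i + 1, ?_, by simpa using h2⟩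
      simp only [List.length_append, List.length_singleton] at h1
      simp only [List.cons_append, numFrom_cons, firstRank, if_neg hd, zeroPos, symCode_eq hB]
      by_cases h0 : prevSymbol u d = Sum.inr 0
      · simp only [h0, if_true, Nat.add_sub_cancel, h1]
        rw [if_neg (by omega)]
        omega
      · simp only [h0, if_false, add_zero, h1]
        omega

/-- If there is no zero of rank `firstRank p`, then `p` is new. -/
theorem notMem_of_count_lt (hB : ∀ s, scode s < B) {p : P} (v r : List (S ⊕ P)) :
    ∀ {u : List (S ⊕ P)}, Sum.inr p ∉ u →
      (numFrom scode B u v).count B < firstRank p u (v ++ r) → Sum.inr p ∉ v := by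
  induction v with
  | nil => intros; simp
  | cons d v ih =>
    intro u hu h
    by_cases hd : d = Sum.inr p
    · subst hd
      simp [numFrom_cons, firstRank, prevSymbol_of_notMem hu, symCode] at h
    · have hu' : Sum.inr p ∉ u ++ [d] := by simpa [hu] using Ne.symm hd
      simp only [List.cons_append, numFrom_cons, firstRank, if_neg hd, List.count_cons,
        beq_iff_eq, symCode_eq hB, Nat.add_lt_add_iff_right] at h
      simpa [Ne.symm hd] using ih hu' h

end

theorem count_link (B : ℕ) : ∀ (X : List ℕ) (a l : ℕ), 1 ≤ a →
    (link B a l X).count B + (if a ≤ X.count B then 1 else 0) = X.count B := by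
  intro X
  induction X with
  | nil => intro a l ha; simp [link]; omega
  | cons x X ih =>
    intro a l ha
    obtain ⟨a, rfl⟩ : ∃ k, a = k + 1 := ⟨a - 1, by omega⟩
    simp only [link]
    by_cases hx : x = B
    · by_cases h0 : a = 0
      · have : ¬ B + l + 1 = B := by omega
        simp [hx, h0, this]
      · have := ih a (l + 1) (by omega)
        simp only [hx, h0, if_true, if_false, List.count_cons_self, Nat.add_le_add_iff_right]
        omega
    · have := ih (a + 1) (l + 1) ha
      simpa [hx, List.count_cons] using this

/-- After the replacement a position holds a `0` if it did so before and was not replaced. -/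
theorem getElem?_link (B : ℕ) : ∀ (X : List ℕ) (a l i : ℕ), 1 ≤ a →
    ((link B a l X)[i]? = some B ↔
      X[i]? = some B ∧ ¬ (a ≤ X.count B ∧ zeroPos B l X a = l + i)) := by
  intro X
  induction X with
  | nil => intro a l i ha; simp [link]
  | cons x X ih =>
    intro a l i ha
    obtain ⟨a, rfl⟩ : ∃ k, a = k + 1 := ⟨a - 1, by omega⟩
    simp only [link, zeroPos]
    by_cases hx : x = B
    · by_cases h0 : a = 0
      · cases i with
        | zero => simp [hx, h0, Nat.add_assoc]
        | succ i => simp [hx, h0]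
      · have h1 : ¬ a + 1 ≤ 1 := by omega
        cases i with
        | zero =>
          have := le_zeroPos B X (l + 1) a
          simp [hx, h0]
          omega
        | succ i =>
          have := ih a (l + 1) i (by omega)
          simp only [hx, h0, h1, if_true, if_false, List.getElem?_cons_succ, this,
            List.count_cons_self, Nat.add_le_add_iff_right, Nat.add_sub_cancel]
          rw [show l + 1 + i = l + (i + 1) by omega]
    · cases i with
      | zero => simp [hx]
      | succ i =>
        have := ih (a + 1) (l + 1) i ha
        simp only [hx, if_false, List.getElem?_cons_succ, this, List.count_cons, beq_iff_eq,
          add_zero]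
        rw [show l + 1 + i = l + (i + 1) by omega]

end

/-! ### The rows of the sorted rotation matrix -/

section
variable {S P : Type*} [LinearOrder S] [DecidableEq P]

/-- The `j`-th rotation in the sorted order. -/
def row (T : List (S ⊕ P)) (j : Fin T.length) : List (S ⊕ P) := T.rotate (tau T j)

/-- The row of the rotation that starts one position earlier than row `j`. -/
def lfMap (T : List (S ⊕ P)) : Equiv.Perm (Fin T.length) :=
  (tau T).trans ((finRotate T.length).symm.trans (tau T).symm)

/-- The row of the rotation that starts with the suffix of length `s + 1`. -/
def suffixRow (T : List (S ⊕ P)) (s : ℕ) (hs : s < T.length) : Fin T.length :=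
  (tau T).symm ⟨T.length - 1 - s, by omega⟩

/-- The suffix of length `s + 1`. -/
def suffix {α : Type*} (T : List α) (s : ℕ) : List α := T.drop (T.length - 1 - s)

@[simp] theorem length_row (T : List (S ⊕ P)) (j : Fin T.length) :
    (row T j).length = T.length := by simp [row]

theorem length_suffix {α : Type*} (T : List α) {s : ℕ} (hs : s < T.length) :
    (suffix T s).length = s + 1 := by simp only [suffix, List.length_drop]; omega

theorem rotate_finRotate {α : Type*} (T : List α) (k : Fin T.length) :
    T.rotate (finRotate T.length k) = (T.rotate k).rotate 1 := by
  rw [List.rotate_rotate]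
  obtain ⟨m, hm⟩ : ∃ m, T.length = m + 1 := ⟨T.length - 1, by have := k.2; omega⟩
  have : ((finRotate T.length k : Fin T.length) : ℕ) = ((k : ℕ) + 1) % T.length := by
    revert k
    rw [hm]
    intro k
    rw [finRotate_apply, Fin.val_add_one]
    split
    · next h => simp [h]
    · next h =>
      rw [Nat.mod_eq_of_lt]
      have := Fin.val_lt_last h
      omega
  rw [this, List.rotate_mod]

theorem row_lfMap (T : List (S ⊕ P)) (j : Fin T.length) :
    ∃ u c, row T j = u ++ [c] ∧ row T (lfMap T j) = c :: u := by
  have h : row T j = (row T (lfMap T j)).rotate 1 := by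
    simp only [row, ← rotate_finRotate, lfMap, Equiv.trans_apply, Equiv.apply_symm_apply]
  cases hr : row T (lfMap T j) with
  | nil =>
    have := length_row T (lfMap T j)
    rw [hr] at this
    exact absurd j.2 (by simp at this; omega)
  | cons c u => exact ⟨u, c, by rw [h, hr]; simp, rfl⟩

theorem row_suffixRow (T : List (S ⊕ P)) {s : ℕ} (hs : s < T.length) :
    row T (suffixRow T s hs) = suffix T s ++ T.take (T.length - 1 - s) := by
  simp only [row, suffixRow, Equiv.apply_symm_apply, suffix]
  exact List.rotate_eq_drop_append_take (by omega)

theorem suffix_succ {α : Type*} (T : List α) {s : ℕ} (hs : s + 1 < T.length) :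
    ∃ c r, suffix T (s + 1) = c :: suffix T s ∧ T.take (T.length - 1 - s) = r ++ [c] ∧
      T[T.length - 1 - (s + 1)]? = some c := by
  refine ⟨T[T.length - 1 - (s + 1)], T.take (T.length - 1 - (s + 1)), ?_, ?_, ?_⟩
  · simp only [suffix]
    rw [List.drop_eq_getElem_cons (by omega)]
    congr 2
    omega
  · rw [show T.length - 1 - s = T.length - 1 - (s + 1) + 1 by omega, List.take_concat_get' _ _]
  · simp

variable {scode : S ↪o ℕ} {B : ℕ}

theorem symCode_lt (hB : ∀ s, scode s < B) {x y : S ⊕ ℕ}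
    (h : symCode scode B x < symCode scode B y) : toLex x < toLex y := by
  rcases x with x | x <;> rcases y with y | y
  · simpa [symCode, Sum.Lex.inl_lt_inl_iff] using h
  · exact Sum.Lex.inl_lt_inr _ _
  · have := hB y
    simp only [symCode, Sum.elim_inl, Sum.elim_inr] at h
    omega
  · simpa [symCode, Sum.Lex.inr_lt_inr_iff] using h

theorem symCode_injective (hB : ∀ s, scode s < B) : Function.Injective (symCode scode B) := by
  rintro (x | x) (y | y) h
  · simpa [symCode] using h
  · have := hB x
    simp only [symCode, Sum.elim_inl, Sum.elim_inr] at h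
    omega
  · have := hB y
    simp only [symCode, Sum.elim_inl, Sum.elim_inr] at h
    omega
  · simpa [symCode] using h

theorem lex_of_lex_map (hB : ∀ s, scode s < B) : ∀ {x y : List (S ⊕ ℕ)},
    List.Lex (· < ·) (x.map (symCode scode B)) (y.map (symCode scode B)) →
    List.Lex (· < ·) (x.map toLex) (y.map toLex)
  | [], [], h => by simp at h
  | [], _ :: _, _ => by simp
  | _ :: _, [], h => by simp at h
  | a :: x, b :: y, h => by
    simp only [List.map_cons, List.cons_lex_cons_iff] at h ⊢
    rcases h with h | ⟨h, h'⟩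
    · exact Or.inl (symCode_lt hB h)
    · exact Or.inr ⟨congrArg toLex (symCode_injective hB h), lex_of_lex_map hB h'⟩

/-- The codes of the symbols preserve the order of the rows. -/
theorem row_mono (hB : ∀ s, scode s < B) (T : List (S ⊕ P)) {i j : Fin T.length} (h : i ≤ j) :
    ¬ List.Lex (· < ·) (numFrom scode B [] (row T j)) (numFrom scode B [] (row T i)) := by
  intro hl
  have h1 : sortKey (row T i) ≤ sortKey (row T j) :=
    Tuple.monotone_sort (fun i : Fin T.length => sortKey (T.rotate i)) h
  have h2 := lex_of_lex_map hB hl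
  rw [← prevEnc_eq, ← prevEnc_eq] at h2
  exact absurd h1 (not_le.mpr h2)

end

theorem key_append (B H : ℕ) (X Y Z : List ℕ) (l : ℕ) (h : X.length ≤ Y.length) :
    key B H l X (Y ++ Z) = key B H l X Y := by
  rw [← key_take B H X (Y ++ Z) l _ h, List.take_left' rfl]

theorem key_prefix (B H : ℕ) : ∀ (X Z : List ℕ) (l : ℕ), key B H l X (X ++ Z) = H := by
  intro X
  induction X with
  | nil => intros; rfl
  | cons x X ih => intro Z l; simp [key, ih]

theorem prefix_of_key (B H : ℕ) : ∀ (X Y : List ℕ) (l : ℕ), X.length ≤ Y.length →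
    2 * (l + X.length) < H → key B H l X Y = H → X <+: Y := by
  intro X
  induction X with
  | nil => simp
  | cons x X ih =>
    intro Y l h hH hk
    cases Y with
    | nil => simp at h
    | cons y Y =>
      simp only [List.length_cons] at h hH
      simp only [key] at hk
      split_ifs at hk with h1
      · subst h1
        exact (List.prefix_cons_inj _).mpr (ih Y (l + 1) (by omega) (by omega) hk)
      all_goals omega

/-- Whether an encoded symbol is static (`0`) or not (`1`). -/
def symTag {α β : Type*} : α ⊕ β → ℕ := Sum.elim (fun _ => 0) (fun _ => 1)

/-- The new key of a row in terms of its old key and the pBWT symbols, given by tags and values,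
of the reference row and of the row. -/
def stepKey (H at' av bt bv z f k pa pb : ℕ) : ℕ :=
  if at' = 0 then if bt = 0 then if bv < av then 0 else if av < bv then 2 * H else shiftKey H k
    else 2 * H
  else if bt = 0 then 0 else nextKey H av bv z f k pa pb

section
variable {S P : Type*} [LinearOrder S] [DecidableEq P] {scode : S ↪o ℕ} {B : ℕ}

/-- The key of a row relative to a suffix. -/
def rowKey (scode : S ↪o ℕ) (B H : ℕ) (T : List (S ⊕ P)) (s : ℕ) (j : Fin T.length) : ℕ :=
  key B H 0 (numFrom scode B [] (suffix T s)) (numFrom scode B [] (row T j))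

theorem rowKey_mono (hB : ∀ s, scode s < B) {T : List (S ⊕ P)} {H s : ℕ} (hs : s < T.length)
    (hH : 2 * T.length < H) {i j : Fin T.length} (h : i ≤ j) :
    rowKey scode B H T s i ≤ rowKey scode B H T s j := by
  have hl := length_suffix T hs
  exact key_mono B H _ _ _ 0 (by simp; omega) (by simp; omega) (by simp; omega) (row_mono hB T h)

theorem rowKey_suffixRow {T : List (S ⊕ P)} {H s : ℕ} (hs : s < T.length) :
    rowKey scode B H T s (suffixRow T s hs) = H := by
  simp only [rowKey, row_suffixRow, numFrom, prevFrom_append, List.map_append]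
  exact key_prefix _ _ _ _ _

theorem getElem?_endMarked {S P : Type*} [LinearOrder S] {T : List (S ⊕ P)} (hT : EndMarked T) :
    ∃ d : S, (∀ s, d ≤ s) ∧ 0 < T.length ∧ ∀ i, T[i]? = some (Sum.inl d) ↔ i = T.length - 1 := by
  obtain ⟨d, u, hd, hu, rfl⟩ := hT
  refine ⟨d, hd, by simp, fun i => ?_⟩
  simp only [List.length_append, List.length_singleton, Nat.add_sub_cancel]
  constructor
  · intro h
    rw [List.getElem?_append] at h
    split at h
    · exact absurd (List.mem_of_getElem? h) hu
    · rw [List.getElem?_singleton] at h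
      split at h
      · omega
      · simp at h
  · rintro rfl
    simp

theorem getElem?_numFrom (hB : ∀ s, scode s < B) (v : List (S ⊕ P)) (i : ℕ) (d : S) :
    (numFrom scode B [] v)[i]? = some (scode d) ↔ v[i]? = some (Sum.inl d) := by
  by_cases hi : i < v.length
  · rw [List.getElem?_eq_getElem (by simpa using hi), List.getElem?_eq_getElem hi]
    simp only [numFrom, List.getElem_map, getElem_prevFrom, Option.some.injEq]
    rw [show scode d = symCode scode B (Sum.inl d) from rfl, (symCode_injective hB).eq_iff]
    cases v[i] with
    | inl s => simp [prevSymbol]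
    | inr p =>
      simp only [prevSymbol, reduceCtorEq, iff_false]
      split <;> simp
  · simp [hi]

/-- Only the row that starts with the suffix has the suffix as a prefix up to renaming, since the
end marker occurs once. -/
theorem eq_suffixRow (hB : ∀ s, scode s < B) {T : List (S ⊕ P)} (hT : EndMarked T) {H s : ℕ}
    (hs : s < T.length) (hH : 2 * T.length < H) {j : Fin T.length}
    (h : rowKey scode B H T s j = H) : j = suffixRow T s hs := by
  have hl := length_suffix T hs
  obtain ⟨d, -, -, hd⟩ := getElem?_endMarked hT
  obtain ⟨Z, hZ⟩ := prefix_of_key B H _ _ 0 (by simp; omega) (by simp; omega) h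
  have h1 : (suffix T s)[s]? = some (Sum.inl d) := by
    rw [suffix, List.getElem?_drop, hd]; omega
  have h2 := (getElem?_numFrom hB _ _ _).mpr h1
  have h3 : (numFrom scode B [] (row T j))[s]? = some (scode d) := by
    rw [← hZ, List.getElem?_append_left (by simp; omega), h2]
  rw [getElem?_numFrom hB, row, List.getElem?_rotate hs, hd] at h3
  simp only [suffixRow, Equiv.eq_symm_apply]
  ext
  have := (tau T j).2
  by_cases hc : s + (tau T j : ℕ) < T.length
  · rw [Nat.mod_eq_of_lt hc] at h3
    simp only; omega
  · rw [Nat.mod_eq_sub_mod (by omega), Nat.mod_eq_of_lt (by omega)] at h3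
    omega

theorem suffix_zero {α : Type*} {T : List α} {d : α} (h0 : 0 < T.length)
    (hd : ∀ i, T[i]? = some d ↔ i = T.length - 1) : suffix T 0 = [d] := by
  refine List.ext_getElem? fun i => ?_
  rw [suffix, List.getElem?_drop]
  cases i with
  | zero => simpa using (hd _).mpr (by omega)
  | succ i => simp; omega

/-- Relative to the end marker the first row has the key of equality, and every other row starts
with a greater symbol. -/
theorem rowKey_zero (hB : ∀ s, scode s < B) {T : List (S ⊕ P)} (hT : EndMarked T) {H : ℕ}
    (h0 : 0 < T.length) (hH : 2 * T.length < H) (j : Fin T.length) :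
    rowKey scode B H T 0 j = if (j : ℕ) = 0 then H else 2 * H := by
  have key0 : ∀ j, j ≠ suffixRow T 0 h0 → rowKey scode B H T 0 j = 2 * H := by
    intro j hj
    have hne : rowKey scode B H T 0 j ≠ H := fun h => hj (eq_suffixRow hB hT h0 hH h)
    obtain ⟨d, hmin, -, hd⟩ := getElem?_endMarked hT
    obtain ⟨c, w, hw⟩ : ∃ c w, row T j = c :: w := by
      cases hr : row T j with
      | nil => have := length_row T j; rw [hr] at this; simp at this; omega
      | cons c w => exact ⟨c, w, rfl⟩
    rw [rowKey, suffix_zero h0 hd, hw] at hne ⊢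
    simp only [numFrom_cons, numFrom_nil, key] at hne ⊢
    split_ifs at hne with h1 h2
    · exact absurd rfl hne
    · simp [h1, h2]
    all_goals
      exfalso
      apply h2
      cases c with
      | inl e =>
        refine lt_of_le_of_ne ?_ (Ne.symm h1)
        simpa [prevSymbol, symCode] using hmin e
      | inr p =>
        have := hB d
        simp only [prevSymbol, symCode, Sum.elim_inl, List.reverse_nil, List.findIdx?_nil,
          Sum.elim_inr]
        omega
  have hi : suffixRow T 0 h0 = ⟨0, h0⟩ := by
    by_contra hne
    have h1 := key0 _ (Ne.symm hne)
    have h2 : rowKey scode B H T 0 (suffixRow T 0 h0) = H := rowKey_suffixRow h0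
    have h3 := rowKey_mono hB h0 hH (Fin.mk_le_of_le_val (Nat.zero_le (suffixRow T 0 h0 : ℕ)))
    omega
  split_ifs with h
  · have : j = suffixRow T 0 h0 := by rw [hi]; exact Fin.ext h
    rw [this]; exact rowKey_suffixRow h0
  · exact key0 j (by rw [hi]; exact fun e => h (congrArg Fin.val e))

theorem numFrom_singleton_of_inl (s : S) (v : List (S ⊕ P)) :
    numFrom scode B [Sum.inl s] v = numFrom scode B [] v := by
  rw [numFrom, prevFrom_inl_cons]; rfl

/-- When the suffix grows by one symbol, the new key of the rotation that starts one position
earlier than row `j` depends only on the old key of row `j`, on the encoding of the old suffix, and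
on two pBWT symbols. -/
theorem rowKey_succ (hB : ∀ s, scode s < B) {T : List (S ⊕ P)} (hT : EndMarked T) {H s : ℕ}
    (hs : s + 1 < T.length) (hH : 2 * T.length < H) (j : Fin T.length) {X : List ℕ}
    (hX : X = numFrom scode B [] (suffix T s)) {a b : S ⊕ ℕ}
    (ha : a = rotSymbol (row T (suffixRow T s (by omega)))) (hb : b = rotSymbol (row T j)) :
    rowKey scode B H T (s + 1) (lfMap T j) =
      stepKey H (symTag a) (Sum.elim scode id a) (symTag b) (Sum.elim scode id b)
        (keyZeros B H 0 X (rowKey scode B H T s j)) (keyFlag B H 0 X (rowKey scode B H T s j))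
        (rowKey scode B H T s j) (zeroPos B 0 X (Sum.elim scode id a))
        (zeroPos B 0 X (Sum.elim scode id b)) := by
  obtain ⟨u, e, hu, hu'⟩ := row_lfMap T j
  obtain ⟨c, r, hc, hr, -⟩ := suffix_succ T hs
  have hl := length_suffix T (show s < T.length by omega)
  have hul : u.length + 1 = T.length := by rw [← length_row T j, hu]; simp
  have hab : rowKey scode B H T s j = H → a = b := by
    intro h
    rw [ha, hb, ← eq_suffixRow hB hT (by omega) hH h]
  set k := rowKey scode B H T s j with hk
  have hk' : k = key B H 0 X (numFrom scode B [] u) := by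
    rw [hk, rowKey, ← hX, hu]
    conv_lhs => rw [numFrom, prevFrom_append, List.map_append]
    exact key_append _ _ _ _ _ _ (by rw [hX]; simp; omega)
  have hXl : X.length = s + 1 := by rw [hX]; simp [hl]
  have hL : rowKey scode B H T (s + 1) (lfMap T j) =
      key B H 0 (symCode scode B (prevSymbol [] c) :: numFrom scode B [c] (suffix T s))
        (symCode scode B (prevSymbol [] e) :: numFrom scode B [e] u) := by
    rw [rowKey, hc, hu']; rfl
  rw [row_suffixRow, hr, ← List.append_assoc] at ha
  rw [hu] at hb
  have hshift := key_succ B H X (numFrom scode B [] u) 0 (by omega)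
  rw [hL]
  cases c with
  | inl c =>
    rw [rotSymbol_append_inl] at ha
    cases e with
    | inl e =>
      rw [rotSymbol_append_inl] at hb
      simp only [ha, hb, stepKey, symTag, Sum.elim_inl, if_true, numFrom_singleton_of_inl, key,
        ← hX, prevSymbol, symCode, hB e, hshift, ← hk']
      rcases lt_trichotomy (scode e) (scode c) with h | h | h
      · simp [h, h.ne, h.not_gt]
      · simp [h]
      · simp [h, h.ne', h.not_gt]
    | inr q =>
      rw [rotSymbol_append_inr] at hb
      have h1 : ¬ B = scode c := (hB c).ne'
      simp [ha, hb, stepKey, symTag, key, prevSymbol, symCode, hB c, h1]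
  | inr p =>
    rw [rotSymbol_append_inr, List.append_assoc] at ha
    have hp := numFrom_inr_cons hB (suffix T s) (r ++ [Sum.inr p]) (u := [])
      (List.not_mem_nil (a := Sum.inr p))
    rw [List.length_nil] at hp
    cases e with
    | inl e =>
      rw [rotSymbol_append_inl] at hb
      have h1 : ¬ scode e = B := (hB e).ne
      have h2 : ¬ B < scode e := (hB e).not_gt
      simp [ha, hb, stepKey, symTag, key, prevSymbol, symCode, hB e, h1, h2]
    | inr q =>
      rw [rotSymbol_append_inr] at hb
      have hq := numFrom_inr_cons hB u [Sum.inr q] (u := []) (List.not_mem_nil (a := Sum.inr q))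
      rw [List.length_nil] at hq
      have := key_link B H X (numFrom scode B [] u) 0 (firstRank p []
        (suffix T s ++ (r ++ [Sum.inr p]))) (firstRank q [] (u ++ [Sum.inr q]))
        (by simp; omega) (by omega) (firstRank_pos _ _ _) (firstRank_pos _ _ _)
        (by rw [hX]; exact bounded_numFrom hB [] _) (bounded_numFrom hB [] _) (by
          rw [← hk']
          intro h
          simpa [ha, hb] using hab h)
      simp only [ha, hb, stepKey, symTag, Sum.elim_inr, key, prevSymbol_of_notMem List.not_mem_nil,
        if_true, hp, hq, ← hX, this, id, ← hk', one_ne_zero, if_false]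

end

/-! ### Counting -/

theorem count_lt_succ (f : ℕ → ℕ) (q n : ℕ) :
    Nat.count (fun j => f j < q + 1) n =
      Nat.count (fun j => f j < q) n + Nat.count (fun j => f j = q) n := by
  induction n with
  | zero => simp
  | succ n ih =>
    simp only [Nat.count_succ, ih]
    split_ifs <;> omega

theorem count_lt_mono {f : ℕ → ℕ} {n j q : ℕ} (hf : ∀ i i', i ≤ i' → i' < n → f i ≤ f i')
    (hj : j < n) : Nat.count (fun i => f i < q + 1) n < j + 1 ↔ q < f j := by
  constructor
  · intro h
    by_contra hq
    have h1 : Nat.count (fun i => f i < q + 1) (j + 1) = j + 1 := by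
      rw [Nat.count_iff_forall]
      intro i hi
      have := hf i j (by omega) hj
      omega
    have := Nat.count_monotone (fun i => f i < q + 1) (show j + 1 ≤ n by omega)
    omega
  · intro h
    obtain ⟨m, rfl⟩ : ∃ m, n = j + m := ⟨n - j, by omega⟩
    have h1 : Nat.count (fun k => f (j + k) < q + 1) m = 0 := by
      rw [Nat.count_iff_forall_not]
      intro k hk
      have := hf j (j + k) (by omega) (by omega)
      omega
    rw [Nat.count_add, h1]
    have := Nat.count_le (p := fun i => f i < q + 1) (n := j)
    omega

theorem count_lt_id (m n : ℕ) (h : m ≤ n) : Nat.count (fun q => q < m) n = m := by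
  induction n with
  | zero => simp; omega
  | succ n ih =>
    rw [Nat.count_succ]
    by_cases hm : m ≤ n
    · rw [ih hm]; split_ifs <;> omega
    · obtain rfl : m = n + 1 := by omega
      have : Nat.count (fun q => q < n + 1) n = n := by
        rw [Nat.count_iff_forall]; omega
      rw [this]; simp

/-- A sorted sequence can be read off from the numbers of its members below each bound. -/
theorem count_count {f g : ℕ → ℕ} {n j m : ℕ} (hf : ∀ i i', i ≤ i' → i' < n → f i ≤ f i')
    (hg : ∀ q, Nat.count (fun i => g i < q + 1) n = Nat.count (fun i => f i < q + 1) n)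
    (hj : j < n) (hm : f j ≤ m) :
    Nat.count (fun q => Nat.count (fun i => g i < q + 1) n < j + 1) m = f j := by
  simp only [hg, count_lt_mono hf hj]
  exact count_lt_id _ _ hm

/-! ### The inversion program

Register `0` holds the length `n`, `1` the key `2 * n + 2` of equality, `2` the current row, `3` the
number of symbols found, `4` and `5` the tag and value of the current pBWT symbol, `6` the number
of zeros in the encoding of the current suffix, and `7` the next row. Array `0` holds the keys of
the rows, `1` and `2` the numbers of zeros and the flags of keys, `3` the positions of zeros, `4`
and `5` counts, and `6`, `7` and `8` the tags and values of the symbols found and whether they are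
encoded as `0`, from the end of the text on. -/

section
open Exp Cmd

/-- Tabulates the zeros of the current suffix. -/
def tablesProg : Cmd :=
  .seq (.set 6 (imm 0)) (.seq (.store 1 (imm 0) (imm 0))
    (.loop 10 (add (reg 3) (imm 1))
      (.seq (.store 1 (add (add (reg 10) (reg 10)) (imm 1)) (reg 6))
      (.seq (.store 1 (sub (add (reg 1) (reg 1)) (add (reg 10) (reg 10))) (reg 6))
      (.seq (.store 2 (add (add (reg 10) (reg 10)) (imm 1)) (imm 1))
      (.seq (.set 11 (arr 8 (sub (reg 3) (reg 10))))
      (.seq (.store 2 (sub (add (reg 1) (reg 1)) (add (reg 10) (reg 10))) (add (reg 11) (reg 11)))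
      (.seq (.set 6 (add (reg 6) (reg 11)))
      (.seq (.store 3 (ifEq (reg 11) (imm 1) (reg 6) (imm 0)) (reg 10))
        (.store 1 (add (add (reg 10) (reg 10)) (imm 2)) (reg 6)))))))))))

/-- Clears the counters. -/
def clearProg : Cmd :=
  .loop 10 (add (add (reg 1) (reg 1)) (imm 1))
    (.seq (.store 4 (reg 10) (imm 0)) (.store 5 (reg 10) (imm 0)))

/-- Computes the new key of row `j` (register `10`) in register `21`. Registers `11` to `15` hold
the tag and value of the pBWT symbol, the key of the row and its entries in the tables, and `16` to
`20` decide the cases of `nextKey` in reverse order. -/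
def stepProg : Cmd :=
  .seq (.set 11 (cell (add (reg 10) (reg 10))))
  (.seq (.set 12 (cell (add (add (reg 10) (reg 10)) (imm 1))))
  (.seq (.set 13 (arr 0 (reg 10)))
  (.seq (.set 14 (arr 1 (reg 13)))
  (.seq (.set 15 (arr 2 (reg 13)))
  (.seq (.set 16 (ifLt (reg 13) (reg 1) (add (reg 13) (imm 2))
    (ifLt (reg 1) (reg 13) (sub (reg 13) (imm 2)) (reg 13))))
  (.seq (.set 17 (ifEq (reg 5) (add (reg 14) (imm 1))
    (ifEq (reg 15) (imm 2) (sub (add (add (reg 1) (reg 1)) (imm 4)) (reg 13)) (reg 16)) (reg 16)))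
  (.seq (.set 18 (ifEq (reg 12) (add (reg 14) (imm 1))
    (ifEq (reg 15) (imm 1) (sub (sub (add (reg 1) (reg 1)) (imm 1)) (reg 13)) (reg 17)) (reg 17)))
  (.seq (.set 19 (ifLt (reg 5) (reg 12) (ifLt (reg 14) (reg 5) (reg 18)
    (add (add (arr 3 (reg 5)) (arr 3 (reg 5))) (imm 3))) (reg 18)))
  (.seq (.set 20 (ifLt (reg 12) (reg 5) (ifLt (reg 14) (reg 12) (reg 19)
    (sub (add (reg 1) (reg 1)) (add (add (arr 3 (reg 12)) (arr 3 (reg 12))) (imm 2)))) (reg 19)))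
    (.set 21 (ifEq (reg 4) (imm 0) (ifEq (reg 11) (imm 0)
      (ifLt (reg 12) (reg 5) (imm 0) (ifLt (reg 5) (reg 12) (add (reg 1) (reg 1)) (reg 16)))
      (add (reg 1) (reg 1))) (ifEq (reg 11) (imm 0) (imm 0) (reg 20)))))))))))))

/-- Counts the new keys. -/
def countProg : Cmd :=
  .seq (.set 7 (imm 0)) (.loop 10 (reg 0) (.seq stepProg
    (.seq (.store 4 (reg 21) (add (arr 4 (reg 21)) (imm 1)))
      (.set 7 (add (reg 7) (ifLt (reg 21) (reg 1) (imm 1) (imm 0)))))))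

/-- Counts how often each number of keys up to a bound occurs. -/
def histProg : Cmd :=
  .seq (.set 11 (imm 0)) (.loop 10 (add (add (reg 1) (reg 1)) (imm 1))
    (.seq (.set 11 (add (reg 11) (arr 4 (reg 10))))
      (.store 5 (reg 11) (add (arr 5 (reg 11)) (imm 1)))))

/-- Writes the sorted sequence of the new keys. -/
def sortProg : Cmd :=
  .seq (.set 11 (imm 0)) (.loop 10 (reg 0)
    (.seq (.set 11 (add (reg 11) (arr 5 (reg 10)))) (.store 0 (reg 10) (reg 11))))

/-- Appends the current symbol to the symbols found. The index `2 * H` serves for a write that has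
no effect. -/
def slotProg : Cmd :=
  .seq (.store 6 (add (reg 3) (imm 1)) (ifEq (reg 4) (imm 0) (imm 0) (imm 1)))
  (.seq (.store 7 (add (reg 3) (imm 1)) (ifEq (reg 4) (imm 0) (reg 5)
    (ifLt (reg 6) (reg 5) (reg 6) (arr 7 (sub (reg 3) (arr 3 (reg 5)))))))
  (.seq (.store 8 (ifEq (reg 4) (imm 0) (add (reg 1) (reg 1)) (ifLt (reg 6) (reg 5)
    (add (reg 1) (reg 1)) (sub (reg 3) (arr 3 (reg 5))))) (imm 0))
  (.seq (.store 8 (add (reg 3) (imm 1)) (ifEq (reg 4) (imm 0) (imm 0) (imm 1)))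
    (.set 2 (reg 7)))))

/-- Prepends one symbol. -/
def bodyProg : Cmd :=
  .seq (.set 4 (cell (add (reg 2) (reg 2))))
  (.seq (.set 5 (cell (add (add (reg 2) (reg 2)) (imm 1))))
  (.seq tablesProg (.seq clearProg (.seq countProg (.seq histProg (.seq sortProg slotProg))))))

/-- Initializes the keys. -/
def initProg : Cmd :=
  .seq (.set 1 (add (add (reg 0) (reg 0)) (imm 2)))
  (.seq (.loop 10 (reg 0) (.store 0 (reg 10) (add (reg 1) (reg 1))))
    (.store 0 (imm 0) (reg 1)))

/-- Finds the end marker and writes the output. -/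
def outputProg : Cmd :=
  .seq (.store 7 (imm 0) (cell (add (add (reg 2) (reg 2)) (imm 1))))
    (.loop 10 (reg 0)
      (.seq (.set 11 (sub (sub (reg 0) (imm 1)) (reg 10)))
      (.seq (.put (add (reg 10) (reg 10)) (arr 6 (reg 11)))
        (.put (add (add (reg 10) (reg 10)) (imm 1)) (arr 7 (reg 11))))))

/-- The inversion of the pBWT. -/
def inversionProg : Cmd :=
  .seq initProg (.seq (.loop 3 (sub (reg 0) (imm 1)) bodyProg) outputProg)

/-! ### Correctness of the program -/

/-- The states that differ from `s` only in the registers of `rs` and the arrays of `as`. -/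
structure Same (rs as : List ℕ) (s s' : St) : Prop where
  cell : s'.cell = s.cell
  reg : ∀ r, r ∉ rs → s'.reg r = s.reg r
  arr : ∀ c, c ∉ as → ∀ x, s'.arr c x = s.arr c x

theorem Same.refl (rs as : List ℕ) (s : St) : Same rs as s s :=
  ⟨rfl, fun _ _ => rfl, fun _ _ _ => rfl⟩

theorem Same.setR {rs as : List ℕ} {s s' : St} (h : Same rs as s s') {r : ℕ} (hr : r ∈ rs) (v : ℕ) :
    Same rs as s (s'.setR r v) := by
  refine ⟨h.cell, fun r' hr' => ?_, h.arr⟩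
  have : r' ≠ r := by rintro rfl; exact hr' hr
  simp [this, h.reg r' hr']

theorem Same.setA {rs as : List ℕ} {s s' : St} (h : Same rs as s s') {c : ℕ} (hc : c ∈ as)
    (x v : ℕ) : Same rs as s (s'.setA c x v) := by
  refine ⟨h.cell, h.reg, fun c' hc' x' => ?_⟩
  have : c' ≠ c := by rintro rfl; exact hc' hc
  simp [this, h.arr c' hc']

theorem wp_clearProg {B n N H : ℕ} {Q : St → Prop} {s : St} (hN : 2 * H + 1 ≤ N) (hB : N < B)
    (hH : s.reg 1 = H)
    (hQ : ∀ s', Same [10] [4, 5] s s' → (∀ q ≤ 2 * H, s'.arr 4 q = 0 ∧ s'.arr 5 q = 0) → Q s') :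
    clearProg.wp B n N Q s := by
  simp only [clearProg, Cmd.wp, Exp.Ok, Exp.val, hH]
  refine ⟨⟨⟨trivial, trivial, by omega⟩, by omega, by omega⟩, by omega,
    fun i s' => Same [10] [4, 5] s s' ∧ ∀ q < i, s'.arr 4 q = 0 ∧ s'.arr 5 q = 0,
    ⟨Same.refl _ _ _, by simp⟩, ?_, ?_⟩
  · rintro i hi s' ⟨hs, h⟩
    refine ⟨by simp, trivial, by simp; omega, by omega, by simp, trivial, by simp; omega,
      by omega, ((hs.setR (by simp) _).setA (by simp) _ _).setA (by simp) _ _, ?_⟩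
    intro q hq
    have := h q
    simp
    omega
  · rintro s' ⟨hs, h⟩
    exact hQ s' hs fun q hq => h q (by omega)

theorem wp_histProg {B n N H : ℕ} {f : ℕ → ℕ} {Q : St → Prop} {s : St} (hN : 2 * H + 1 ≤ N)
    (hnN : n < N) (hB : N + n < B)
    (hH : s.reg 1 = H) (h4 : ∀ q ≤ 2 * H, s.arr 4 q = Nat.count (fun j => f j = q) n)
    (h5 : ∀ q ≤ n, s.arr 5 q = 0)
    (hQ : ∀ s', Same [10, 11] [5] s s' → (∀ m ≤ n, s'.arr 5 m =
      Nat.count (fun q => Nat.count (fun j => f j < q + 1) n = m) (2 * H + 1)) → Q s') :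
    histProg.wp B n N Q s := by
  simp only [histProg, Cmd.wp, Exp.Ok, Exp.val]
  simp only [St.setR_reg, hH, if_neg (show ¬ 1 = 11 by omega)]
  refine ⟨by omega, ⟨⟨trivial, trivial, by omega⟩, by omega, by omega⟩, by omega,
    fun i s' => Same [10, 11] [5] s s' ∧ s'.reg 11 = Nat.count (fun j => f j < i) n ∧
      ∀ m ≤ n, s'.arr 5 m = Nat.count (fun q => Nat.count (fun j => f j < q + 1) n = m) i,
    ⟨(Same.refl _ _ _).setR (by simp) _, by simp, by simpa using h5⟩, ?_, ?_⟩
  · rintro i hi s' ⟨hs, h, h'⟩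
    have e4 : s'.arr 4 i = Nat.count (fun j => f j = i) n := by
      rw [hs.arr 4 (by simp), h4 i (by omega)]
    have e := count_lt_succ f i n
    rw [← h, ← e4] at e
    have hle := Nat.count_le (p := fun j => f j < i + 1) (n := n)
    have hle' := Nat.count_le (p := fun q => Nat.count (fun j => f j < q + 1) n =
      Nat.count (fun j => f j < i + 1) n) (n := i)
    have e5 := h' _ hle
    simp only [St.setR_reg, St.setR_arr, St.setA_reg, St.setA_arr, if_true,
      if_neg (show ¬ 11 = 10 by omega), ← e, e5, true_and]
    refine ⟨⟨by omega, by omega⟩, by omega, by omega, ⟨by omega, by omega, by omega⟩,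
      ((hs.setR (by simp) _).setR (by simp) _).setA (by simp) _ _, fun m hm => ?_⟩
    rw [Nat.count_succ, ← h' m hm]
    by_cases hm' : m = Nat.count (fun j => f j < i + 1) n
    · subst hm'
      rw [if_pos rfl, if_pos rfl, e5]
    · rw [if_neg hm', if_neg (Ne.symm hm'), add_zero]
  · rintro s' ⟨hs, -, h⟩
    rw [← two_mul] at h
    exact hQ s' hs h

/-- Array `5` tells for how many bounds the number of keys up to the bound has each value, and its
prefix sums are the sorted keys. -/
theorem wp_sortProg {B n N H : ℕ} {f g : ℕ → ℕ} {Q : St → Prop} {s : St}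
    (hnN : n < N) (hB : 2 * H + 1 < B) (h0 : s.reg 0 = n)
    (hf : ∀ i i', i ≤ i' → i' < n → f i ≤ f i')
    (hg : ∀ q, Nat.count (fun i => g i < q + 1) n = Nat.count (fun i => f i < q + 1) n)
    (hm : ∀ j < n, f j ≤ 2 * H)
    (h5 : ∀ m ≤ n, s.arr 5 m =
      Nat.count (fun q => Nat.count (fun j => g j < q + 1) n = m) (2 * H + 1))
    (hQ : ∀ s', Same [10, 11] [0] s s' → (∀ j < n, s'.arr 0 j = f j) → Q s') :
    sortProg.wp B n N Q s := by
  simp only [sortProg, Cmd.wp, Exp.Ok, Exp.val]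
  simp only [St.setR_reg, h0, if_neg (show ¬ 0 = 11 by omega)]
  refine ⟨by omega, trivial, by omega,
    fun i s' => Same [10, 11] [0] s s' ∧
      s'.reg 11 = Nat.count (fun q => Nat.count (fun j => g j < q + 1) n < i) (2 * H + 1) ∧
      ∀ j < i, s'.arr 0 j = f j,
    ⟨(Same.refl _ _ _).setR (by simp) _, by simp, by simp⟩, ?_, ?_⟩
  · rintro i hi s' ⟨hs, h, h'⟩
    have e5 : s'.arr 5 i =
        Nat.count (fun q => Nat.count (fun j => g j < q + 1) n = i) (2 * H + 1) := by
      rw [hs.arr 5 (by simp), h5 i (by omega)]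
    have e := count_lt_succ (fun q => Nat.count (fun j => g j < q + 1) n) i (2 * H + 1)
    have hfi := hm i hi
    rw [← h, ← e5, count_count hf hg hi (by omega)] at e
    have e' := count_count hf hg hi (m := 2 * H + 1) (by omega)
    simp only [St.setR_reg, St.setR_arr, St.setA_reg, St.setA_arr, if_true,
      if_neg (show ¬ 11 = 10 by omega), if_neg (show ¬ 10 = 11 by omega), ← e, true_and]
    refine ⟨⟨by omega, by omega⟩, by omega, by omega,
      ((hs.setR (by simp) _).setR (by simp) _).setA (by simp) _ _, e'.symm, fun j hj => ?_⟩
    split_ifs with hji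
    · rw [hji]
    · exact h' j (by omega)
  · rintro s' ⟨hs, -, h⟩
    exact hQ s' hs h

/-- The data that the program handles, for a reference suffix of each length `s + 1`: tags `tg` and
values `vl` of the pBWT symbols, keys `K s` of the rows, encodings `X s` of the suffixes, and rows
`I s` that start with them. The new keys are given only up to their order of rows. -/
structure Inversion (B n H : ℕ) (tg vl : ℕ → ℕ) (K : ℕ → ℕ → ℕ) (X : ℕ → List ℕ) (I : ℕ → ℕ) :
    Prop where
  pos : 0 < n
  eqKey : H = 2 * n + 2
  length : ∀ s < n, (X s).length = s + 1
  row_lt : ∀ s < n, I s < n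
  row_zero : I 0 = 0
  val_pos : ∀ j < n, tg j ≠ 0 → 1 ≤ vl j
  key_zero : ∀ j < n, K 0 j = if j = 0 then H else 2 * H
  key_mono : ∀ s < n, ∀ i i', i ≤ i' → i' < n → K s i ≤ K s i'
  key_eq : ∀ s < n, ∀ j < n, K s j = H ↔ j = I s
  key_le : ∀ s < n, ∀ j < n, K s j ≤ 2 * H
  key_small : ∀ s < n, ∀ j < n, K s j < H → K s j ≤ 2 * (s + 1)
  key_large : ∀ s < n, ∀ j < n, H < K s j → K s j % 2 = 0 ∧ 2 * H + 2 ≤ K s j + 2 * (s + 1)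
  new_count : ∀ s, s + 1 < n → ∀ (p : ℕ → Prop) [DecidablePred p],
    Nat.count (fun j => p (stepKey H (tg (I s)) (vl (I s)) (tg j) (vl j)
      (keyZeros B H 0 (X s) (K s j)) (keyFlag B H 0 (X s) (K s j)) (K s j)
      (zeroPos B 0 (X s) (vl (I s))) (zeroPos B 0 (X s) (vl j)))) n =
    Nat.count (fun j => p (K (s + 1) j)) n
  zero_start : (X 0)[0]? ≠ some B
  zero_static : ∀ s, s + 1 < n → tg (I s) = 0 → (X (s + 1))[0]? ≠ some B ∧
    ∀ i, (X (s + 1))[i + 1]? = some B ↔ (X s)[i]? = some B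
  zero_param : ∀ s, s + 1 < n → tg (I s) ≠ 0 → (X (s + 1))[0]? = some B ∧
    ∀ i, (X (s + 1))[i + 1]? = some B ↔ (X s)[i]? = some B ∧
      ¬ (vl (I s) ≤ (X s).count B ∧ zeroPos B 0 (X s) (vl (I s)) = i)

theorem wp_set_seq {B n N r : ℕ} {e : Exp} {q : Cmd} {Q : St → Prop} {s : St}
    (ok : e.Ok B n N s) (h : ∀ v, v = e.val s → q.wp B n N Q (s.setR r v)) :
    (Cmd.seq (.set r e) q).wp B n N Q s := ⟨ok, h _ rfl⟩

theorem wp_stepProg {B n N H j k z f at' av bt bv : ℕ} {pz : ℕ → ℕ} {Q : St → Prop} {s : St}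
    (hH : H = 2 * n + 2) (hN : 2 * H + 1 ≤ N) (hB : 2 * N + 10 < B) (hj : j < n)
    (h1 : s.reg 1 = H) (h4 : s.reg 4 = at') (h5 : s.reg 5 = av) (h10 : s.reg 10 = j)
    (hbt : s.cell (2 * j) = bt) (hbv : s.cell (2 * j + 1) = bv)
    (hk : s.arr 0 j = k) (hkH : k ≤ 2 * H) (hz : s.arr 1 k = z) (hzn : z ≤ n)
    (hf : s.arr 2 k = f) (h3 : ∀ m, s.arr 3 m ≤ n) (hpz : ∀ m, 1 ≤ m → m ≤ z → s.arr 3 m = pz m)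
    (ha : at' ≠ 0 → 1 ≤ av) (hb : bt ≠ 0 → 1 ≤ bv)
    (hQ : ∀ s', Same [11, 12, 13, 14, 15, 16, 17, 18, 19, 20, 21] [] s s' →
      s'.reg 21 = stepKey H at' av bt bv z f k (pz av) (pz bv) → Q s') :
    stepProg.wp B n N Q s := by
  rw [two_mul] at hbt hbv
  refine wp_set_seq ⟨⟨trivial, trivial, ?_⟩, ?_⟩ fun x11 e11 => ?_
  · simp [h10]; omega
  · simp [h10]; omega
  simp only [Exp.val, h10, hbt] at e11
  subst e11
  refine wp_set_seq ⟨⟨⟨trivial, trivial, ?_⟩, ?_, ?_⟩, ?_⟩ fun x12 e12 => ?_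
  · simp [h10]; omega
  · simp; omega
  · simp [h10]; omega
  · simp [h10]; omega
  simp [h10, hbv] at e12
  subst e12
  refine wp_set_seq ⟨by omega, trivial, ?_⟩ fun x13 e13 => ?_
  · simp [h10]; omega
  simp [h10, hk] at e13
  subst e13
  refine wp_set_seq ⟨by omega, trivial, ?_⟩ fun x14 e14 => ?_
  · simp; omega
  simp [hz] at e14
  subst e14
  refine wp_set_seq ⟨by omega, trivial, ?_⟩ fun x15 e15 => ?_
  · simp; omega
  simp [hf] at e15
  subst e15
  refine wp_set_seq ?_ fun x16 e16 => ?_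
  · simp [h1]; omega
  simp [h1] at e16
  refine wp_set_seq ?_ fun x17 e17 => ?_
  · simp [h1]; omega
  simp [h1, h5] at e17
  refine wp_set_seq ?_ fun x18 e18 => ?_
  · simp [h1]; omega
  simp [h1] at e18
  refine wp_set_seq ?_ fun x19 e19 => ?_
  · have := h3 av
    simp [h5]; omega
  simp [h5] at e19
  refine wp_set_seq ?_ fun x20 e20 => ?_
  · have := h3 x12
    simp [h5, h1]; omega
  simp [h5, h1] at e20
  refine ⟨?_, ?_⟩
  · simp [h5, h4, h1]; omega
  refine hQ _ ?_ ?_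
  · iterate 11 refine Same.setR ?_ (by simp) _
    exact Same.refl _ _ _
  replace e16 : x16 = shiftKey H x13 := e16
  have ea := hpz av
  have eb := hpz x12
  simp [h4, h5, h1, stepKey, two_mul]
  by_cases c0 : at' = 0
  · simp only [c0, if_true, e16]
  · by_cases c1 : x11 = 0
    · simp only [c0, c1, if_true, if_false]
    · replace ea := ea (ha c0)
      replace eb := eb (hb c1)
      have av0 := ha c0
      have bv0 := hb c1
      simp only [c0, c1, if_false, nextKey, ← e16]
      clear e16 hQ h3 hpz
      rw [e20, e19]
      by_cases c2 : x12 < av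
      · have c3 : ¬ av < x12 := by omega
        simp only [c2, c3, if_true, if_false, true_and, false_and]
        rw [e18, e17]
        split_ifs <;> omega
      · by_cases c3 : av < x12
        · simp only [c2, c3, if_true, if_false, true_and, false_and]
          rw [e18, e17]
          split_ifs <;> omega
        · simp only [c2, c3, if_false, false_and]
          rw [e18, e17]
          split_ifs <;> omega

/-! ### The tables of the current suffix -/

theorem count_take_succ (B : ℕ) (X : List ℕ) (i : ℕ) :
    (X.take (i + 1)).count B = (X.take i).count B + if X[i]? = some B then 1 else 0 := by
  rw [List.take_add_one, List.count_append]
  congr 1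
  cases X[i]? with
  | none => simp
  | some x => simp [List.count_singleton]

/-- Array `8` tells the zeros of the encoding `X` of the current suffix, from its end on. One pass
over it tabulates `keyZeros` and `keyFlag` by keys, and `zeroPos` by ranks. -/
theorem wp_tablesProg {B n N H t : ℕ} {X : List ℕ} {Q : St → Prop} {s : St}
    (hH : H = 2 * n + 2) (hN : 2 * H + 1 ≤ N) (hB : 2 * N + 10 < B) (ht : t < n)
    (h1 : s.reg 1 = H) (h3 : s.reg 3 = t) (hX : X.length = t + 1)
    (zr : ∀ k ≤ t, s.arr 8 k = if X[t - k]? = some B then 1 else 0)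
    (zp : ∀ m, s.arr 3 m ≤ n) (fe : ∀ i, 2 * i ≤ H → s.arr 2 (2 * i) = 0) (zh : s.arr 1 H = 0)
    (hQ : ∀ s', Same [6, 10, 11] [1, 2, 3] s s' → s'.reg 6 = X.count B →
      (∀ m, s'.arr 3 m ≤ n) → (∀ m, 1 ≤ m → m ≤ X.count B → s'.arr 3 m = zeroPos B 0 X m) →
      (∀ i, 2 * i ≤ H → s'.arr 2 (2 * i) = 0) → s'.arr 1 H = 0 →
      (∀ i ≤ t + 1, s'.arr 1 (2 * i) = (X.take i).count B) →
      (∀ i ≤ t, s'.arr 1 (2 * i + 1) = (X.take i).count B ∧ s'.arr 2 (2 * i + 1) = 1 ∧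
        s'.arr 1 (2 * H - 2 * i) = (X.take i).count B ∧
        s'.arr 2 (2 * H - 2 * i) = if X[i]? = some B then 2 else 0) → Q s') :
    tablesProg.wp B n N Q s := by
  simp only [tablesProg, Cmd.wp, Exp.Ok]
  refine ⟨by omega, by omega, by omega, by simp; omega, by omega,
    ⟨trivial, by omega, by simp [h3]; omega⟩, by simp [h3]; omega, ?_⟩
  simp only [Exp.val, St.setA_reg, St.setR_reg, h3, if_neg (show ¬ 3 = 6 by omega)]
  refine ⟨fun i s' => Same [6, 10, 11] [1, 2, 3] s s' ∧ s'.reg 6 = (X.take i).count B ∧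
      (∀ m, s'.arr 3 m ≤ n) ∧
      (∀ m, 1 ≤ m → m ≤ (X.take i).count B → s'.arr 3 m = zeroPos B 0 X m) ∧
      (∀ i, 2 * i ≤ H → s'.arr 2 (2 * i) = 0) ∧ s'.arr 1 H = 0 ∧
      (∀ k ≤ i, s'.arr 1 (2 * k) = (X.take k).count B) ∧
      (∀ k < i, s'.arr 1 (2 * k + 1) = (X.take k).count B ∧ s'.arr 2 (2 * k + 1) = 1 ∧
        s'.arr 1 (2 * H - 2 * k) = (X.take k).count B ∧
        s'.arr 2 (2 * H - 2 * k) = if X[k]? = some B then 2 else 0),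
    ⟨((Same.refl _ _ _).setR (by simp) _).setA (by simp) _ _, by simp, by simpa using zp, ?_,
      by simpa using fe, ?_, ?_, by simp⟩, ?_, ?_⟩
  · simp; omega
  · simp [zh]
  · simp
  · rintro i hi s' ⟨hs, h6, hzp, hz, hfe, hzh, he, ho⟩
    have e1 : s'.reg 1 = H := by rw [hs.reg 1 (by simp), h1]
    have e3 : s'.reg 3 = t := by rw [hs.reg 3 (by simp), h3]
    have e8 : s'.arr 8 (t - i) = if X[i]? = some B then 1 else 0 := by
      rw [hs.arr 8 (by simp), zr _ (by omega), show t - (t - i) = i by omega]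
    have hc := count_take_succ B X i
    have hci : (X.take i).count B ≤ n := by
      refine List.count_le_length.trans ?_
      simp; omega
    have hzc := zeroPos_count B X 0 i
    set c := (X.take i).count B with hcd
    set e := if X[i]? = some B then 1 else 0 with hed
    have he1 : e ≤ 1 := by rw [hed]; split_ifs <;> omega
    have hz' : X[i]? = some B → zeroPos B 0 X (c + 1) = i := by
      intro h; rw [hzc h]; omega
    have hei : e = 1 ↔ X[i]? = some B := by
      rw [hed]; split_ifs with h <;> simp [h]
    simp only [St.setR_reg, St.setR_arr, St.setA_reg, St.setA_arr, e1, e3, e8, h6, hc,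
      Nat.reduceEqDiff, if_true, if_false, false_and, and_true, true_and]
    and_intros
    any_goals omega
    · exact fun _ => trivial
    · split_ifs <;> omega
    · exact ((((((((hs.setR (by simp) _).setA (by simp) _ _).setA (by simp) _ _).setA (by simp)
        _ _).setR (by simp) _).setA (by simp) _ _).setR (by simp) _).setA (by simp) _ _).setA
        (by simp) _ _
    · intro m
      have := hzp m
      split_ifs <;> omega
    · intro m hm1 hm2
      by_cases hm : m ≤ c
      · rw [if_neg (by split_ifs <;> omega)]
        exact hz m hm1 hm
      · have h1 : e = 1 := by omega
        obtain rfl : m = c + 1 := by omega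
        rw [if_pos (by simp [h1]), hz' (hei.mp h1)]
    · intro k hk
      rw [if_neg (by omega), if_neg (by omega)]
      exact hfe k hk
    · rw [if_neg (by omega), if_neg (by omega), if_neg (by omega)]
      exact hzh
    · intro k hk
      by_cases hki : k = i + 1
      · rw [if_pos (by omega), hki, hc]
      · rw [if_neg (by omega), if_neg (by omega), if_neg (by omega)]
        exact he k (by omega)
    · intro k hk
      by_cases hki : k = i
      · subst hki
        rw [if_neg (by omega), if_neg (by omega), if_pos (by omega), if_neg (by omega),
          if_pos (by omega), if_neg (by omega), if_pos (by omega), if_pos (by omega)]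
        refine ⟨rfl, rfl, rfl, ?_⟩
        rw [hed]; split_ifs <;> rfl
      · rw [if_neg (by omega), if_neg (by omega), if_neg (by omega), if_neg (by omega),
          if_neg (by omega), if_neg (by omega), if_neg (by omega), if_neg (by omega),
          if_neg (by omega), if_neg (by omega)]
        exact ho k (by omega)
  · rintro s' ⟨hs, h6, hzp, hz, hfe, hzh, he, ho⟩
    rw [List.take_of_length_le (by omega)] at h6 hz
    exact hQ s' hs h6 hzp hz hfe hzh he fun i hi => ho i (by omega)

/-! ### One round of the main loop -/

/-- The tables hold the number of zeros and the flag of each key that can occur. -/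
theorem table_lookup {B H t k : ℕ} {X : List ℕ} {s : St} (hH : 2 * (t + 1) < H) (hk : k ≤ 2 * H)
    (hX : X.length = t + 1)
    (h1 : k < H → k ≤ 2 * (t + 1)) (h2 : H < k → k % 2 = 0 ∧ 2 * H + 2 ≤ k + 2 * (t + 1))
    (fe : ∀ i, 2 * i ≤ H → s.arr 2 (2 * i) = 0) (hH2 : H % 2 = 0) (zh : s.arr 1 H = 0)
    (ze : ∀ i ≤ t + 1, s.arr 1 (2 * i) = (X.take i).count B)
    (zo : ∀ i ≤ t, s.arr 1 (2 * i + 1) = (X.take i).count B ∧ s.arr 2 (2 * i + 1) = 1 ∧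
        s.arr 1 (2 * H - 2 * i) = (X.take i).count B ∧
        s.arr 2 (2 * H - 2 * i) = if X[i]? = some B then 2 else 0) :
    s.arr 1 k = keyZeros B H 0 X k ∧ s.arr 2 k = keyFlag B H 0 X k ∧
      keyZeros B H 0 X k ≤ t + 1 := by
  have hle : keyZeros B H 0 X k ≤ t + 1 := by
    unfold keyZeros
    split
    · omega
    · exact List.count_le_length.trans (by simp; omega)
  refine ⟨?_, ?_, hle⟩
  · rcases lt_trichotomy k H with h | h | h
    · simp only [keyZeros, keyPos, if_pos h, if_neg h.ne, Nat.sub_zero]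
      rcases Nat.even_or_odd' k with ⟨i, rfl | rfl⟩
      · rw [ze i (by have := h1 h; omega)]; congr 2; omega
      · rw [(zo i (by have := h1 h; omega)).1]; congr 2; omega
    · simp [keyZeros, h, zh]
    · obtain ⟨h3, h4⟩ := h2 h
      obtain ⟨i, rfl⟩ : ∃ i, k = 2 * H - 2 * i := ⟨H - k / 2, by omega⟩
      simp only [keyZeros, keyPos, if_neg h.not_gt, if_neg h.ne', Nat.sub_zero]
      rw [(zo i (by omega)).2.2.1]; congr 2; omega
  · rcases lt_trichotomy k H with h | h | h
    · simp only [keyFlag, if_pos h]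
      rcases Nat.even_or_odd' k with ⟨i, rfl | rfl⟩
      · rw [fe i (by omega)]; omega
      · rw [(zo i (by have := h1 h; omega)).2.1]; omega
    · have := fe (H / 2) (by omega)
      rw [show 2 * (H / 2) = H by omega] at this
      simp [keyFlag, h, this]
    · obtain ⟨h3, h4⟩ := h2 h
      obtain ⟨i, rfl⟩ : ∃ i, k = 2 * H - 2 * i := ⟨H - k / 2, by omega⟩
      have hi : (2 * H - (2 * H - 2 * i)) / 2 = i := by omega
      simp only [keyFlag, keyPos, if_neg h.not_gt, h, true_and, Nat.sub_zero, hi]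
      rw [(zo i (by omega)).2.2.2, List.getD_eq_getElem _ _ (by omega : i < X.length),
        List.getElem?_eq_getElem (by omega)]
      simp

theorem wp_countProg {B n N H at' av : ℕ} {f tg vl k z fl pz : ℕ → ℕ} {Q : St → Prop} {s : St}
    (hH : H = 2 * n + 2) (hN : 2 * H + 1 ≤ N) (hB : 2 * N + 10 < B)
    (h0 : s.reg 0 = n) (h1 : s.reg 1 = H) (h4 : s.reg 4 = at') (h5 : s.reg 5 = av)
    (hc : ∀ j < n, s.cell (2 * j) = tg j ∧ s.cell (2 * j + 1) = vl j)
    (hk : ∀ j < n, s.arr 0 j = k j ∧ k j ≤ 2 * H ∧ s.arr 1 (k j) = z j ∧ z j ≤ n ∧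
      s.arr 2 (k j) = fl j ∧ ∀ m, 1 ≤ m → m ≤ z j → s.arr 3 m = pz m)
    (h3 : ∀ m, s.arr 3 m ≤ n)
    (ha : at' ≠ 0 → 1 ≤ av) (hb : ∀ j < n, tg j ≠ 0 → 1 ≤ vl j)
    (hf : ∀ j < n, f j = stepKey H at' av (tg j) (vl j) (z j) (fl j) (k j) (pz av) (pz (vl j)))
    (hfH : ∀ j < n, f j ≤ 2 * H) (hs4 : ∀ q ≤ 2 * H, s.arr 4 q = 0)
    (hQ : ∀ s', Same [7, 10, 11, 12, 13, 14, 15, 16, 17, 18, 19, 20, 21] [4] s s' →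
      (∀ q ≤ 2 * H, s'.arr 4 q = Nat.count (fun j => f j = q) n) →
      s'.reg 7 = Nat.count (fun j => f j < H) n → Q s') :
    countProg.wp B n N Q s := by
  simp only [countProg, Cmd.wp, Exp.Ok]
  refine ⟨by omega, trivial, by simp [h0]; omega, ?_⟩
  simp only [Exp.val, St.setR_reg, h0, if_neg (show ¬ 0 = 7 by omega)]
  refine ⟨fun i s' => Same [7, 10, 11, 12, 13, 14, 15, 16, 17, 18, 19, 20, 21] [4] s s' ∧
      (∀ q ≤ 2 * H, s'.arr 4 q = Nat.count (fun j => f j = q) i) ∧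
      s'.reg 7 = Nat.count (fun j => f j < H) i,
    ⟨(Same.refl _ _ _).setR (by simp) _, by simpa using hs4, by simp⟩, ?_, ?_⟩
  · rintro i hi s' ⟨hs, hcount, h7⟩
    obtain ⟨k1, k2, k3, k4, k5, k6⟩ := hk i hi
    refine wp_stepProg (j := i) (at' := at') (av := av) (bt := tg i) (bv := vl i) (k := k i)
      (z := z i) (f := fl i) (pz := pz) hH hN hB hi ?_ ?_ ?_ (by simp) ?_ ?_ ?_ k2 ?_ k4 ?_ ?_ ?_
      ha (hb i hi) ?_
    · simp [hs.reg 1 (by simp), h1]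
    · simp [hs.reg 4 (by simp), h4]
    · simp [hs.reg 5 (by simp), h5]
    · simp [hs.cell, (hc i hi).1]
    · simp [hs.cell, (hc i hi).2]
    · simp [hs.arr 0 (by simp), k1]
    · simp [hs.arr 1 (by simp), k3]
    · simp [hs.arr 2 (by simp), k5]
    · intro m; simp [hs.arr 3 (by simp), h3]
    · intro m h1 h2; simp [hs.arr 3 (by simp), k6 m h1 h2]
    · intro s2 hs2 h21
      rw [← hf i hi] at h21
      have hfi := hfH i hi
      have hs3 : Same [7, 10, 11, 12, 13, 14, 15, 16, 17, 18, 19, 20, 21] [4] s s2 := by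
        refine ⟨hs2.cell.trans hs.cell, fun r hr => ?_, fun c hc x => ?_⟩
        · rw [hs2.reg r (by simp at hr ⊢; omega), St.setR_reg, if_neg (by simp at hr; omega),
            hs.reg r hr]
        · rw [hs2.arr c (by simp), St.setR_arr, hs.arr c hc]
      have e7 : s2.reg 7 = Nat.count (fun j => f j < H) i := by
        rw [hs2.reg 7 (by simp)]; simpa using h7
      have e4 : ∀ q ≤ 2 * H, s2.arr 4 q = Nat.count (fun j => f j = q) i := fun q hq => by
        rw [hs2.arr 4 (by simp)]; simpa using hcount q hq
      have e1 : s2.reg 1 = H := by rw [hs3.reg 1 (by simp), h1]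
      have l1 := Nat.count_le (p := fun j => f j = f i) (n := i)
      have l2 := Nat.count_le (p := fun j => f j < H) (n := i)
      simp only [St.setR_reg, St.setA_reg, St.setA_arr, St.setR_arr, h21, e4 _ hfi, e7, e1,
        if_true, true_and, and_true, Nat.count_succ]
      and_intros
      any_goals omega
      · split_ifs <;> omega
      · exact (hs3.setA (by simp) _ _).setR (by simp) _
      · intro q hq
        rw [e4 q hq]
        by_cases hqf : q = f i
        · subst hqf; simp
        · rw [if_neg hqf, if_neg (Ne.symm hqf), add_zero]
  · rintro s' ⟨hs, h4', h7⟩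
    exact hQ s' hs h4' h7

theorem wp_slotProg {B n N H at' av z t : ℕ} {Q : St → Prop} {s : St}
    (hH : H = 2 * n + 2) (hN : 2 * H + 1 ≤ N) (hB : 2 * N + 10 < B) (ht : t < n)
    (h1 : s.reg 1 = H) (h3 : s.reg 3 = t) (h4 : s.reg 4 = at') (h5 : s.reg 5 = av)
    (h6 : s.reg 6 = z) (hz : z ≤ n)
    (hQ : ∀ s', Same [2] [6, 7, 8] s s' → s'.reg 2 = s.reg 7 →
      (∀ k, s'.arr 6 k = if k = t + 1 then if at' = 0 then 0 else 1 else s.arr 6 k) →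
      (∀ k, s'.arr 7 k = if k = t + 1 then if at' = 0 then av else if z < av then z else
        s.arr 7 (t - s.arr 3 av) else s.arr 7 k) →
      (∀ k ≤ t, s'.arr 8 k = if at' ≠ 0 ∧ av ≤ z ∧ k = t - s.arr 3 av then 0 else s.arr 8 k) →
      (s'.arr 8 (t + 1) = if at' = 0 then 0 else 1) → Q s') :
    slotProg.wp B n N Q s := by
  simp only [slotProg, Cmd.wp, Exp.Ok, Exp.val, St.setA_reg, h1, h3, h4, h5, h6, St.setA_arr,
    Nat.reduceEqDiff, false_and, if_false, true_and, implies_true]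
  and_intros
  any_goals omega
  · split_ifs <;> omega
  · refine hQ _ ?_ ?_ ?_ ?_ ?_ ?_
    · exact (((((Same.refl _ _ _).setA (by simp) _ _).setA (by simp) _ _).setA (by simp)
        _ _).setA (by simp) _ _).setR (by simp) _
    · simp
    · intro k; simp
    · intro k; simp
    · intro k hk
      have : k ≠ t + 1 := by omega
      simp [this]
      split_ifs <;> omega
    · simp

/-- The state of the program when the symbols after the suffix of length `t + 1` are found. -/
structure LoopInv (B n H : ℕ) (tg vl : ℕ → ℕ) (K : ℕ → ℕ → ℕ) (X : ℕ → List ℕ) (I : ℕ → ℕ)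
    (t : ℕ) (s : St) : Prop where
  len : s.reg 0 = n
  eqKey : s.reg 1 = H
  row : s.reg 2 = I t
  cell : ∀ j < n, s.cell (2 * j) = tg j ∧ s.cell (2 * j + 1) = vl j
  keys : ∀ j < n, s.arr 0 j = K t j
  even : ∀ i, 2 * i ≤ H → s.arr 2 (2 * i) = 0
  mid : s.arr 1 H = 0
  zeroPos : ∀ m, s.arr 3 m ≤ n
  zero : ∀ k ≤ t, s.arr 8 k = if (X t)[t - k]? = some B then 1 else 0
  tag_zero : s.arr 6 0 = 0
  tag : ∀ k < t, s.arr 6 (k + 1) = if tg (I k) = 0 then 0 else 1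
  val : ∀ k < t, s.arr 7 (k + 1) = if tg (I k) = 0 then vl (I k) else
    if (X k).count B < vl (I k) then (X k).count B else
      s.arr 7 (k - PBWT.zeroPos B 0 (X k) (vl (I k)))

section
variable {B n N H : ℕ} {tg vl : ℕ → ℕ} {K : ℕ → ℕ → ℕ} {X : ℕ → List ℕ} {I : ℕ → ℕ}

/-- The row that starts with the suffix comes after the rows of smaller keys. -/
theorem Inversion.count_row (h : Inversion B n H tg vl K X I) {t : ℕ} (ht : t < n) :
    Nat.count (fun j => K t j < H) n = I t := by
  have hI := h.row_lt t ht
  have hK := (h.key_eq t ht _ hI).mpr rfl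
  obtain ⟨m, hm⟩ : ∃ m, n = I t + m := ⟨n - I t, by omega⟩
  have h1 : Nat.count (fun j => K t j < H) (I t) = I t := by
    rw [Nat.count_iff_forall]
    intro j hj
    have := h.key_mono t ht j (I t) hj.le hI
    have := mt (h.key_eq t ht j (by omega)).mp (by omega)
    omega
  have h2 : Nat.count (fun j => K t (I t + j) < H) m = 0 := by
    rw [Nat.count_iff_forall_not]
    intro j hj
    have := h.key_mono t ht (I t) (I t + j) (by omega) (by omega)
    omega
  conv_lhs => rw [hm]
  rw [Nat.count_add, h1, h2]
  rfl

/-- One round replaces the suffix by the next longer one. The new keys belong to rows permuted by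
`lfMap`, but as keys grow with the rows it suffices to sort them. -/
theorem wp_bodyProg (h : Inversion B n H tg vl K X I) (hN : 2 * H + 1 ≤ N)
    (hB : 2 * N + n + 10 < B) {t : ℕ} (ht : t + 1 < n) {s : St}
    (hs : LoopInv B n H tg vl K X I t s) :
    bodyProg.wp B n N (LoopInv B n H tg vl K X I (t + 1)) (s.setR 3 t) := by
  have hH := h.eqKey
  have hI := h.row_lt t (by omega)
  have hXl := h.length t (by omega)
  obtain ⟨c1, c2⟩ := hs.cell _ hI
  rw [two_mul] at c1 c2
  refine wp_set_seq ?_ fun v4 e4 => wp_set_seq ?_ fun v5 e5 => ?_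
  · simp [hs.row]; omega
  · simp [hs.row]; omega
  simp [hs.row, c1] at e4
  simp [hs.row, c2] at e5
  subst e4 e5
  set s1 := ((s.setR 3 t).setR 4 (tg (I t))).setR 5 (vl (I t)) with hs1
  have S1 : Same [3, 4, 5] [] s s1 :=
    (((Same.refl _ _ _).setR (by simp) _).setR (by simp) _).setR (by simp) _
  have r3 : s1.reg 3 = t := by simp [hs1]
  have r4 : s1.reg 4 = tg (I t) := by simp [hs1]
  have r5 : s1.reg 5 = vl (I t) := by simp [hs1]
  clear_value s1
  refine wp_tablesProg (X := X t) hH hN (by omega) (by omega : t < n)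
    (by rw [S1.reg 1 (by simp), hs.eqKey]) r3 hXl
    (fun k hk => by rw [S1.arr 8 (by simp), hs.zero k hk])
    (fun m => by rw [S1.arr 3 (by simp)]; exact hs.zeroPos m)
    (fun i hi => by rw [S1.arr 2 (by simp)]; exact hs.even i hi)
    (by rw [S1.arr 1 (by simp), hs.mid]) ?_
  intro s2 S2 z6 zp2 pos2 even2 mid2 ze2 zo2
  refine wp_clearProg (H := H) hN (by omega) ?_ ?_
  · rw [S2.reg 1 (by simp), S1.reg 1 (by simp), hs.eqKey]
  intro s3 S3 clear3
  -- The new keys.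
  set f : ℕ → ℕ := fun j => stepKey H (tg (I t)) (vl (I t)) (tg j) (vl j)
      (keyZeros B H 0 (X t) (K t j)) (keyFlag B H 0 (X t) (K t j)) (K t j)
      (PBWT.zeroPos B 0 (X t) (vl (I t))) (PBWT.zeroPos B 0 (X t) (vl j)) with hf
  have hcount : ∀ (p : ℕ → Prop) [DecidablePred p],
      Nat.count (fun j => p (f j)) n = Nat.count (fun j => p (K (t + 1) j)) n :=
    fun p _ => h.new_count t ht p
  have hfH : ∀ j < n, f j ≤ 2 * H := by
    have h1 : Nat.count (fun j => f j ≤ 2 * H) n = n := by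
      rw [hcount (· ≤ 2 * H), Nat.count_iff_forall]
      exact h.key_le (t + 1) ht
    rw [Nat.count_iff_forall] at h1
    exact fun j hj => h1 j hj
  have hcle : (X t).count B ≤ n := List.count_le_length.trans (by omega)
  refine wp_countProg (H := H) (at' := tg (I t)) (av := vl (I t)) (f := f) (tg := tg) (vl := vl)
    (k := K t) (z := fun j => keyZeros B H 0 (X t) (K t j))
    (fl := fun j => keyFlag B H 0 (X t) (K t j)) (pz := PBWT.zeroPos B 0 (X t))
    hH hN (by omega) ?_ ?_ ?_ ?_ ?_ ?_ ?_ (h.val_pos _ hI) h.val_pos (fun _ _ => rfl) hfH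
    (fun q hq => (clear3 q hq).1) ?_
  · rw [S3.reg 0 (by simp), S2.reg 0 (by simp), S1.reg 0 (by simp), hs.len]
  · rw [S3.reg 1 (by simp), S2.reg 1 (by simp), S1.reg 1 (by simp), hs.eqKey]
  · rw [S3.reg 4 (by simp), S2.reg 4 (by simp), r4]
  · rw [S3.reg 5 (by simp), S2.reg 5 (by simp), r5]
  · rw [S3.cell, S2.cell, S1.cell]; exact hs.cell
  · intro j hj
    have kz := h.key_le t (by omega) j hj
    obtain ⟨l1, l2, l3⟩ := table_lookup (s := s2) (X := X t) (t := t) (by omega) kz hXl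
      (h.key_small t (by omega) j hj) (h.key_large t (by omega) j hj) even2 (by omega) mid2 ze2 zo2
    refine ⟨?_, kz, ?_, by omega, ?_, fun m hm1 hm2 => ?_⟩
    · rw [S3.arr 0 (by simp), S2.arr 0 (by simp), S1.arr 0 (by simp), hs.keys j hj]
    · rw [S3.arr 1 (by simp), l1]
    · rw [S3.arr 2 (by simp), l2]
    · rw [S3.arr 3 (by simp)]
      refine pos2 m hm1 (hm2.trans ?_)
      unfold keyZeros
      split
      · exact Nat.zero_le _
      · exact (List.take_sublist _ _).count_le _
  · intro m; rw [S3.arr 3 (by simp)]; exact zp2 m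
  intro s4 S4 count4 row4
  refine wp_histProg (H := H) (f := f) hN (by omega) (by omega) ?_ count4 ?_ ?_
  · rw [S4.reg 1 (by simp), S3.reg 1 (by simp), S2.reg 1 (by simp), S1.reg 1 (by simp), hs.eqKey]
  · intro q hq
    rw [S4.arr 5 (by simp), (clear3 q (by omega)).2]
  intro s5 S5 hist5
  refine wp_sortProg (H := H) (f := K (t + 1)) (g := f) (by omega) (by omega) ?_
    (h.key_mono _ ht) (fun q => hcount (· < q + 1)) (h.key_le _ ht) hist5 ?_
  · rw [S5.reg 0 (by simp), S4.reg 0 (by simp), S3.reg 0 (by simp), S2.reg 0 (by simp),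
      S1.reg 0 (by simp), hs.len]
  intro s6 S6 keys6
  have R : ∀ r, r ∉ [3, 4, 5, 6, 7, 10, 11, 12, 13, 14, 15, 16, 17, 18, 19, 20, 21] →
      s6.reg r = s.reg r := by
    intro r hr
    simp at hr
    rw [S6.reg r (by simp; omega), S5.reg r (by simp; omega), S4.reg r (by simp; omega),
      S3.reg r (by simp; omega), S2.reg r (by simp; omega), S1.reg r (by simp; omega)]
  have A : ∀ c, c ∉ [0, 1, 2, 3, 4, 5] → ∀ x, s6.arr c x = s.arr c x := by
    intro c hc x
    simp at hc
    rw [S6.arr c (by simp; omega), S5.arr c (by simp; omega), S4.arr c (by simp; omega),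
      S3.arr c (by simp; omega), S2.arr c (by simp; omega), S1.arr c (by simp)]
  have A3 : ∀ c ∈ [1, 2, 3], ∀ x, s6.arr c x = s2.arr c x := by
    intro c hc x
    simp at hc
    rw [S6.arr c (by simp; omega), S5.arr c (by simp; omega), S4.arr c (by simp; omega),
      S3.arr c (by simp; omega)]
  have hpos : tg (I t) ≠ 0 → vl (I t) ≤ (X t).count B →
      s6.arr 3 (vl (I t)) = PBWT.zeroPos B 0 (X t) (vl (I t)) ∧ s6.arr 3 (vl (I t)) ≤ t := by
    intro ha hz
    have hv := h.val_pos _ hI ha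
    have := zeroPos_lt B (X t) 0 _ hv hz
    rw [A3 3 (by simp), pos2 _ hv hz]
    omega
  refine wp_slotProg (H := H) (at' := tg (I t)) (av := vl (I t)) (z := (X t).count B) (t := t)
    hH hN (by omega) (by omega) ?_ ?_ ?_ ?_ ?_ hcle ?_
  · rw [R 1 (by simp), hs.eqKey]
  · rw [S6.reg 3 (by simp), S5.reg 3 (by simp), S4.reg 3 (by simp), S3.reg 3 (by simp),
      S2.reg 3 (by simp), r3]
  · rw [S6.reg 4 (by simp), S5.reg 4 (by simp), S4.reg 4 (by simp), S3.reg 4 (by simp),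
      S2.reg 4 (by simp), r4]
  · rw [S6.reg 5 (by simp), S5.reg 5 (by simp), S4.reg 5 (by simp), S3.reg 5 (by simp),
      S2.reg 5 (by simp), r5]
  · rw [S6.reg 6 (by simp), S5.reg 6 (by simp), S4.reg 6 (by simp), S3.reg 6 (by simp), z6]
  intro s7 S7 row7 tag7 val7 zero7 zero7'
  have hold : ∀ k ≤ t, s7.arr 7 k = s.arr 7 k := by
    intro k hk
    rw [val7, if_neg (by omega), A 7 (by simp)]
  refine ⟨?_, ?_, ?_, ?_, ?_, ?_, ?_, ?_, ?_, ?_, ?_, ?_⟩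
  · rw [S7.reg 0 (by simp), R 0 (by simp), hs.len]
  · rw [S7.reg 1 (by simp), R 1 (by simp), hs.eqKey]
  · rw [row7, S6.reg 7 (by simp), S5.reg 7 (by simp), row4, hcount (· < H), h.count_row ht]
  · rw [S7.cell, S6.cell, S5.cell, S4.cell, S3.cell, S2.cell, S1.cell]; exact hs.cell
  · intro j hj
    rw [S7.arr 0 (by simp), keys6 j hj]
  · intro i hi
    rw [S7.arr 2 (by simp), A3 2 (by simp), even2 i hi]
  · rw [S7.arr 1 (by simp), A3 1 (by simp), mid2]
  · intro m
    rw [S7.arr 3 (by simp), A3 3 (by simp)]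
    exact zp2 m
  · intro k hk
    by_cases hkt : k = t + 1
    · subst hkt
      rw [zero7', Nat.sub_self]
      by_cases ha : tg (I t) = 0
      · rw [if_pos ha, if_neg (h.zero_static t ht ha).1]
      · rw [if_neg ha, if_pos (h.zero_param t ht ha).1]
    · have hk' : k ≤ t := by omega
      rw [zero7 k hk', A 8 (by simp), hs.zero k hk', show t + 1 - k = t - k + 1 by omega]
      by_cases ha : tg (I t) = 0
      · simp only [ha, ne_eq, not_true, false_and, if_false, (h.zero_static t ht ha).2]
      · simp only [(h.zero_param t ht ha).2, ne_eq, ha, not_false_eq_true, true_and]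
        by_cases hz : vl (I t) ≤ (X t).count B
        · obtain ⟨p1, p2⟩ := hpos ha hz
          simp only [hz, true_and, ← p1]
          by_cases hkp : k = t - s6.arr 3 (vl (I t))
          · rw [if_pos hkp, if_neg]
            rintro ⟨-, h2⟩
            omega
          · rw [if_neg hkp]
            have : s6.arr 3 (vl (I t)) ≠ t - k := by omega
            simp [this]
        · simp [hz]
  · rw [tag7, if_neg (by omega), A 6 (by simp), hs.tag_zero]
  · intro k hk
    rw [tag7]
    by_cases hkt : k = t
    · subst hkt; simp
    · rw [if_neg (by omega), A 6 (by simp), hs.tag k (by omega)]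
  · intro k hk
    by_cases hkt : k = t
    · subst hkt
      rw [val7, if_pos rfl]
      split_ifs with ha hz
      · rfl
      · rfl
      · rw [(hpos ha (by omega)).1, hold _ (by omega), A 7 (by simp)]
    · rw [hold _ (by omega), hs.val k (by omega)]
      split_ifs
      · rfl
      · rfl
      · rw [hold _ (by omega)]

end

/-! ### Initialization and output -/

theorem wp_initProg {B n N H : ℕ} {Q : St → Prop} {s : St}
    (hH : H = 2 * n + 2) (hn : 0 < n) (hN : 2 * H + 1 ≤ N) (hB : 2 * N + 10 < B) (h0 : s.reg 0 = n)
    (hQ : ∀ s', Same [1, 10] [0] s s' → s'.reg 1 = H →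
      (∀ j < n, s'.arr 0 j = if j = 0 then H else 2 * H) → Q s') :
    initProg.wp B n N Q s := by
  simp only [initProg, Cmd.wp, Exp.Ok, Exp.val, h0, St.setR_reg, if_neg (show ¬ 0 = 1 by omega),
    true_and, show n + n + 2 = H by omega]
  refine ⟨by omega, by omega, fun i s' => Same [1, 10] [0] s s' ∧ s'.reg 1 = H ∧
      ∀ j < i, s'.arr 0 j = 2 * H,
    ⟨(Same.refl _ _ _).setR (by simp) _, by simp, by simp⟩, ?_, ?_⟩
  · rintro i hi s' ⟨hs, h1, h⟩
    simp only [St.setA_reg, St.setR_reg, St.setA_arr, St.setR_arr, Nat.reduceEqDiff, if_false,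
      if_true, h1, true_and]
    and_intros
    any_goals omega
    · exact (hs.setR (by simp) _).setA (by simp) _ _
    · intro j hj
      split_ifs with hji
      · omega
      · exact h j (by omega)
  · rintro s' ⟨hs, h1, h⟩
    refine ⟨by omega, by omega, by omega, hQ _ (hs.setA (by simp) _ _) h1 fun j hj => ?_⟩
    simp only [St.setA_arr, true_and]
    split_ifs
    · exact h1
    · exact h j hj

theorem wp_outputProg {B n N v : ℕ} {Q : St → Prop} {s : St}
    (hn : 0 < n) (hnN : n ≤ N) (hB : 2 * N + 10 < B) (h0 : s.reg 0 = n)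
    (h2 : s.reg 2 < n) (hv : s.cell (2 * s.reg 2 + 1) = v)
    (hQ : ∀ s', (∀ j < n, s'.cell (2 * j) = s.arr 6 (n - 1 - j) ∧
      s'.cell (2 * j + 1) = if j = n - 1 then v else s.arr 7 (n - 1 - j)) → Q s') :
    outputProg.wp B n N Q s := by
  rw [two_mul] at hv
  simp only [outputProg, Cmd.wp, Exp.Ok, Exp.val, St.setA_reg, h0, true_and, hv]
  refine ⟨by omega, by omega, by omega, ⟨⟨by omega, by omega, by omega⟩, by omega⟩, by omega,
    fun i s' => s'.reg 0 = n ∧ (∀ c x, s'.arr c x = (s.setA 7 0 v).arr c x) ∧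
      ∀ j < i, s'.cell (2 * j) = s.arr 6 (n - 1 - j) ∧
        s'.cell (2 * j + 1) = if j = n - 1 then v else s.arr 7 (n - 1 - j),
    ⟨h0, fun _ _ => rfl, by simp⟩, ?_, ?_⟩
  · rintro i hi s' ⟨e0, ea, h⟩
    simp only [St.setC_reg, St.setR_reg, St.setC_arr, St.setC_cell, St.setR_arr, St.setR_cell,
      Nat.reduceEqDiff, if_false, if_true, e0, true_and, ea, St.setA_arr, false_and,
      OfNat.zero_ne_ofNat]
    and_intros
    any_goals omega
    · trivial
    · exact fun _ _ => trivial
    · intro j hj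
      by_cases hji : j = i
      · subst hji
        rw [if_neg (by omega), if_pos (by omega), if_pos (by omega)]
        refine ⟨rfl, ?_⟩
        split_ifs <;> omega
      · rw [if_neg (by omega), if_neg (by omega), if_neg (by omega), if_neg (by omega)]
        exact h j (by omega)
  · rintro s' ⟨-, -, h⟩
    exact hQ s' h

/-- The program outputs the symbols found, where each parameter symbol is given the value of its
last occurrence in the known suffix, or the number of parameter symbols of the suffix if it is
new. -/
theorem wp_inversionProg {B n N H : ℕ} {tg vl : ℕ → ℕ} {K : ℕ → ℕ → ℕ} {X : ℕ → List ℕ} {I : ℕ → ℕ}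
    (h : Inversion B n H tg vl K X I) (hN : 2 * H + 1 ≤ N) (hB : 2 * N + n + 10 < B) {s : St}
    (h0 : s.reg 0 = n) (h2 : s.reg 2 = 0)
    (hc : ∀ j < n, s.cell (2 * j) = tg j ∧ s.cell (2 * j + 1) = vl j)
    (ha : ∀ c x, s.arr c x = 0) {Q : St → Prop}
    (hQ : ∀ (A V : ℕ → ℕ) s', (∀ j < n, s'.cell (2 * j) = A (n - 1 - j) ∧
        s'.cell (2 * j + 1) = if j = n - 1 then vl (I (n - 1)) else V (n - 1 - j)) →
      A 0 = 0 → (∀ k, k + 1 < n → A (k + 1) = if tg (I k) = 0 then 0 else 1) →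
      (∀ k, k + 1 < n → V (k + 1) = if tg (I k) = 0 then vl (I k) else
        if (X k).count B < vl (I k) then (X k).count B else
          V (k - zeroPos B 0 (X k) (vl (I k)))) → Q s') :
    inversionProg.wp B n N Q s := by
  have hH := h.eqKey
  have hn := h.pos
  refine wp_initProg hH hn hN (by omega) h0 ?_
  intro s1 S1 r1 keys1
  have e0 : s1.reg 0 = n := by rw [S1.reg 0 (by simp), h0]
  simp only [Cmd.wp, Exp.Ok, Exp.val, e0]
  refine ⟨⟨trivial, by omega⟩, by omega, LoopInv B n H tg vl K X I, ?_, ?_, ?_⟩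
  · refine ⟨e0, r1, ?_, ?_, ?_, ?_, ?_, ?_, ?_, ?_, ?_, ?_⟩
    · rw [S1.reg 2 (by simp), h2, h.row_zero]
    · rw [S1.cell]; exact hc
    · intro j hj
      rw [keys1 j hj, h.key_zero j hj]
    · intro i _; rw [S1.arr 2 (by simp), ha]
    · rw [S1.arr 1 (by simp), ha]
    · intro m; rw [S1.arr 3 (by simp), ha]; omega
    · intro k hk
      obtain rfl : k = 0 := by omega
      rw [S1.arr 8 (by simp), ha, if_neg h.zero_start]
    · rw [S1.arr 6 (by simp), ha]
    · omega
    · omega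
  · intro t ht s' hs
    exact wp_bodyProg h hN hB (by omega) hs
  · intro s2 hs
    have hI := h.row_lt (n - 1) (by omega)
    refine wp_outputProg hn (by omega) (by omega) hs.len (by rw [hs.row]; exact hI)
      (by rw [hs.row, (hs.cell _ hI).2]) fun s3 h3 => ?_
    exact hQ (s2.arr 6) (s2.arr 7) s3 h3 hs.tag_zero (fun k hk => hs.tag k (by omega))
      fun k hk => hs.val k (by omega)

end

/-! ### The data of a text and the renaming found -/

theorem count_perm {n : ℕ} (e : Equiv.Perm (Fin n)) (F G : ℕ → Prop) [DecidablePred F]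
    [DecidablePred G] (h : ∀ j : Fin n, F j ↔ G (e j)) : Nat.count F n = Nat.count G n := by
  simp only [Nat.count_eq_card_filter_range, Finset.card_filter, Finset.sum_range]
  rw [← Equiv.sum_comp e (fun j : Fin n => if G j then 1 else 0)]
  exact Finset.sum_congr rfl fun j _ => if_congr (h j) rfl rfl

section
variable {S P : Type*} [LinearOrder S] [DecidableEq P] {scode : S ↪o ℕ} {B : ℕ}

/-- The encoding of the next longer suffix, in terms of its first symbol and the pBWT symbol of the
row of the current suffix. -/
theorem suffix_step (hB : ∀ s, scode s < B) (T : List (S ⊕ P)) {t : ℕ} (ht : t + 1 < T.length)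
    {X : List ℕ} (hX : X = numFrom scode B [] (suffix T t)) {a : S ⊕ ℕ}
    (ha : a = rotSymbol (row T (suffixRow T t (by omega)))) :
    ∃ c, suffix T (t + 1) = c :: suffix T t ∧ T[T.length - 1 - (t + 1)]? = some c ∧
      ((∃ d, c = Sum.inl d ∧ a = Sum.inl d ∧
        numFrom scode B [] (suffix T (t + 1)) = scode d :: X) ∨
      ∃ p k, c = Sum.inr p ∧ a = Sum.inr k ∧ 1 ≤ k ∧
        numFrom scode B [] (suffix T (t + 1)) = B :: link B k 0 X ∧
        (k ≤ X.count B → (suffix T t)[zeroPos B 0 X k]? = some (Sum.inr p)) ∧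
        (X.count B < k → Sum.inr p ∉ suffix T t)) := by
  obtain ⟨c, r, hc, hr, hc'⟩ := suffix_succ T ht
  refine ⟨c, hc, hc', ?_⟩
  rw [row_suffixRow, hr, ← List.append_assoc] at ha
  rw [hc]
  cases c with
  | inl d =>
    rw [rotSymbol_append_inl] at ha
    refine Or.inl ⟨d, rfl, ha, ?_⟩
    rw [hX, numFrom_cons, List.nil_append, numFrom_singleton_of_inl]
    rfl
  | inr p =>
    rw [rotSymbol_append_inr, List.append_assoc] at ha
    have h0 : (Sum.inr p : S ⊕ P) ∉ ([] : List (S ⊕ P)) := List.not_mem_nil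
    have h1 := numFrom_inr_cons hB (suffix T t) (r ++ [Sum.inr p]) h0
    have h2 := getElem_zeroPos hB (suffix T t) (r ++ [Sum.inr p]) h0
    have h3 := notMem_of_count_lt hB (suffix T t) (r ++ [Sum.inr p]) h0
    rw [← hX] at h1 h2 h3
    refine Or.inr ⟨p, _, rfl, ha, firstRank_pos _ _ _, ?_, fun h => ?_, h3⟩
    · rw [numFrom_cons, List.nil_append, h1, prevSymbol_of_notMem h0]
      rfl
    · obtain ⟨i, hi, hi'⟩ := h2 h
      simp only [List.length_nil, zero_add] at hi
      rwa [hi]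

/-- The tag of the `j`-th pBWT symbol. -/
def rowTag (T : List (S ⊕ P)) (j : ℕ) : ℕ :=
  if h : j < T.length then symTag (rotSymbol (row T ⟨j, h⟩)) else 0

/-- The value of the `j`-th pBWT symbol. -/
def rowVal (scode : S ↪o ℕ) (T : List (S ⊕ P)) (j : ℕ) : ℕ :=
  if h : j < T.length then Sum.elim scode id (rotSymbol (row T ⟨j, h⟩)) else 0

/-- `rowKey` with a number as row index. -/
def natKey (scode : S ↪o ℕ) (B H : ℕ) (T : List (S ⊕ P)) (s j : ℕ) : ℕ :=
  if h : j < T.length then rowKey scode B H T s ⟨j, h⟩ else 0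

/-- `suffixRow` as a number. -/
def natRow (T : List (S ⊕ P)) (s : ℕ) : ℕ :=
  if h : s < T.length then suffixRow T s h else 0

/-- The data of an end-marked text satisfy what the correctness of the program needs. -/
theorem inversion (hB : ∀ s, scode s < B) {T : List (S ⊕ P)} (hT : EndMarked T) {H : ℕ}
    (hH : H = 2 * T.length + 2) :
    Inversion B T.length H (rowTag T) (rowVal scode T) (natKey scode B H T)
      (fun s => numFrom scode B [] (suffix T s)) (natRow T) := by
  obtain ⟨d, -, hn, hd⟩ := getElem?_endMarked hT
  have hlen : ∀ s < T.length, (numFrom scode B [] (suffix T s)).length = s + 1 := fun s hs => by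
    rw [length_numFrom, length_suffix T hs]
  have bounds : ∀ s (hs : s < T.length) j,
      rowKey scode B H T s j ≤ 2 * H ∧ (rowKey scode B H T s j < H →
        rowKey scode B H T s j ≤ 2 * (s + 1)) ∧ (H < rowKey scode B H T s j →
        rowKey scode B H T s j % 2 = 0 ∧ 2 * H + 2 ≤ rowKey scode B H T s j + 2 * (s + 1)) := by
    intro s hs j
    have := key_bounds B H (numFrom scode B [] (suffix T s)) (numFrom scode B [] (row T j)) 0
      (by rw [hlen s hs]; omega)
    rw [hlen s hs, zero_add] at this
    exact ⟨this.2.1, this.2.2⟩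
  have keyeq : ∀ s (hs : s < T.length) j, rowKey scode B H T s j = H ↔ j = suffixRow T s hs :=
    fun s hs j => ⟨eq_suffixRow hB hT hs (by omega), by rintro rfl; exact rowKey_suffixRow hs⟩
  have tagRow : ∀ s (hs : s < T.length), rowTag T (natRow T s) =
      symTag (rotSymbol (row T (suffixRow T s hs))) := fun s hs => by simp [natRow, hs, rowTag]
  have valRow : ∀ s (hs : s < T.length), rowVal scode T (natRow T s) =
      Sum.elim scode id (rotSymbol (row T (suffixRow T s hs))) :=
    fun s hs => by simp [natRow, hs, rowVal]
  constructor
  · exact hn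
  · exact hH
  · exact hlen
  · intro s hs
    simp [natRow, hs]
  · have h0 := rowKey_zero hB hT hn (H := H) (by omega) (suffixRow T 0 hn)
    rw [rowKey_suffixRow] at h0
    rw [natRow, dif_pos hn]
    by_contra hne
    rw [if_neg hne] at h0
    omega
  · intro j hj ht
    obtain ⟨u, c, hu, -⟩ := row_lfMap T ⟨j, hj⟩
    simp only [rowTag, rowVal, dif_pos hj, hu] at ht ⊢
    cases c with
    | inl c => simp [rotSymbol_append_inl, symTag] at ht
    | inr p => simpa [rotSymbol_append_inr] using firstRank_pos _ _ _
  · intro j hj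
    rw [natKey, dif_pos hj, rowKey_zero hB hT hn (by omega)]
  · intro s hs i i' hi hi'
    rw [natKey, natKey, dif_pos (by omega), dif_pos hi']
    exact rowKey_mono hB hs (by omega) (Fin.mk_le_mk.mpr hi)
  · intro s hs j hj
    rw [natKey, dif_pos hj, keyeq s hs, natRow, dif_pos hs, Fin.ext_iff]
  · intro s hs j hj
    rw [natKey, dif_pos hj]; exact (bounds s hs _).1
  · intro s hs j hj
    rw [natKey, dif_pos hj]; exact (bounds s hs _).2.1
  · intro s hs j hj
    rw [natKey, dif_pos hj]; exact (bounds s hs _).2.2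
  · intro s hs p _
    refine count_perm (lfMap T) _ _ fun j => ?_
    have := rowKey_succ hB hT hs (H := H) (by omega) j rfl rfl rfl
    rw [tagRow s (by omega), valRow s (by omega)]
    simp only [natKey, rowTag, rowVal, Fin.is_lt, dif_pos, Fin.eta, this]
  · simp only [suffix_zero hn hd, numFrom_cons, numFrom_nil, List.getElem?_cons_zero, ne_eq,
      Option.some.injEq]
    exact (hB d).ne
  · intro s hs h0
    obtain ⟨c, -, -, ⟨e, -, he, hX⟩ | ⟨p, k, -, hk, -⟩⟩ := suffix_step hB T hs rfl rfl
    · simp only [hX, List.getElem?_cons_zero, List.getElem?_cons_succ, ne_eq, Option.some.injEq,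
        implies_true, and_true]
      exact (hB e).ne
    · rw [tagRow s (by omega), hk] at h0
      simp [symTag] at h0
  · intro s hs h0
    obtain ⟨c, -, -, ⟨e, -, he, hX⟩ | ⟨p, k, -, hk, hk1, hX, -⟩⟩ := suffix_step hB T hs rfl rfl
    · rw [tagRow s (by omega), he] at h0
      simp [symTag] at h0
    · rw [valRow s (by omega), hk]
      simp only [hX, List.getElem?_cons_zero, List.getElem?_cons_succ, true_and, Sum.elim_inr, id]
      intro i
      rw [getElem?_link B _ k 0 i hk1, zero_add]

/-- A renaming that maps the set `M` of known parameter symbols onto the codes below `z` can be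
changed outside of `M` so that a new symbol gets the code `z`. -/
theorem perm_update {P : Type*} [DecidableEq P] {σp : ℕ} (pcode : P ≃ Fin σp) (f : Equiv.Perm P)
    {M : P → Prop} {z : ℕ} (h : ∀ q, M q ↔ (pcode (f q) : ℕ) < z) {p : P} (hp : ¬ M p) :
    ∃ g : Equiv.Perm P, (∀ q, M q → g q = f q) ∧ (pcode (g p) : ℕ) = z ∧
      ∀ q, (q = p ∨ M q) ↔ (pcode (g q) : ℕ) < z + 1 := by
  have hz : z ≤ (pcode (f p) : ℕ) := not_lt.mp fun hlt => hp ((h p).mpr hlt)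
  have hz' : z < σp := hz.trans_lt (pcode (f p)).2
  set r : P := pcode.symm ⟨z, hz'⟩ with hr
  have hrz : (pcode r : ℕ) = z := by simp [hr]
  have h1 : ∀ q, M q → Equiv.swap (f p) r (f q) = f q := by
    intro q hq
    have := (h q).mp hq
    refine Equiv.swap_apply_of_ne_of_ne (fun e => ?_) fun e => ?_
    · rw [e] at this; omega
    · rw [e] at this; omega
  have h2 : Equiv.swap (f p) r (f p) = r := Equiv.swap_apply_left _ _
  refine ⟨f.trans (Equiv.swap (f p) r), h1, by rw [Equiv.trans_apply, h2, hrz], fun q => ?_⟩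
  rw [Equiv.trans_apply]
  constructor
  · rintro (rfl | hq)
    · rw [h2]; omega
    · rw [h1 q hq]
      have := (h q).mp hq
      omega
  · intro hq
    by_contra hne
    rw [not_or] at hne
    have h3 : z ≤ (pcode (f q) : ℕ) := not_lt.mp fun hlt => hne.2 ((h q).mpr hlt)
    have h4 : f q ≠ f p := fun e => hne.1 (f.injective e)
    by_cases h5 : f q = r
    · rw [h5, Equiv.swap_apply_right] at hq
      have h6 : f p = r := by
        apply pcode.injective
        ext
        omega
      exact h4 (h5.trans h6.symm)
    · rw [Equiv.swap_apply_of_ne_of_ne h4 h5] at hq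
      apply h5
      apply pcode.injective
      ext
      omega

/-- The values that the program assigns are those of a renaming of the parameter symbols. -/
theorem exists_renaming (hB : ∀ s, scode s < B) {T : List (S ⊕ P)} (hT : EndMarked T) {σp : ℕ}
    (pcode : P ≃ Fin σp) {V : ℕ → ℕ}
    (hV : ∀ k, k + 1 < T.length → V (k + 1) =
      if rowTag T (natRow T k) = 0 then rowVal scode T (natRow T k) else
      if (numFrom scode B [] (suffix T k)).count B < rowVal scode T (natRow T k) then
        (numFrom scode B [] (suffix T k)).count B else
      V (k - zeroPos B 0 (numFrom scode B [] (suffix T k)) (rowVal scode T (natRow T k)))) :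
    ∀ t < T.length, ∃ f : Equiv.Perm P,
      (∀ q, Sum.inr q ∈ suffix T t ↔
        (pcode (f q) : ℕ) < (numFrom scode B [] (suffix T t)).count B) ∧
      ∀ i < t, ∀ c, (suffix T t)[i]? = some c →
        V (t - i) = Sum.elim scode (fun p => (pcode (f p) : ℕ)) c := by
  obtain ⟨d, -, hn, hd⟩ := getElem?_endMarked hT
  intro t
  induction t with
  | zero =>
    intro _
    refine ⟨Equiv.refl P, fun q => ?_, by omega⟩
    have : ¬ scode d = B := (hB d).ne
    simp [suffix_zero hn hd, numFrom_cons, numFrom_nil, prevSymbol, symCode, this]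
  | succ t ih =>
    intro ht
    obtain ⟨f, hf, hfV⟩ := ih (by omega)
    have hVt := hV t ht
    have tagRow : rowTag T (natRow T t) =
        symTag (rotSymbol (row T (suffixRow T t (by omega)))) := by
      simp [natRow, show t < T.length by omega, rowTag]
    have valRow : rowVal scode T (natRow T t) =
        Sum.elim scode id (rotSymbol (row T (suffixRow T t (by omega)))) := by
      simp [natRow, show t < T.length by omega, rowVal]
    set X := numFrom scode B [] (suffix T t) with hX
    obtain ⟨c, hc, -, ⟨e, rfl, he, hX'⟩ | ⟨p, k, rfl, hk, hk1, hX', hle, hgt⟩⟩ :=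
      suffix_step hB T ht hX rfl
    · have hne : ¬ scode e = B := (hB e).ne
      refine ⟨f, fun q => ?_, fun i hi c' hc' => ?_⟩
      · rw [hX', hc]
        simp [hf q, hne]
      · rw [hc] at hc'
        cases i with
        | zero =>
          simp only [List.getElem?_cons_zero, Option.some.injEq] at hc'
          subst hc'
          rw [Nat.sub_zero, hVt, tagRow, valRow, he]
          rfl
        | succ i =>
          rw [Nat.add_sub_add_right]
          exact hfV i (by omega) c' (by simpa using hc')
    · have hval : rowVal scode T (natRow T t) = k := by rw [valRow, hk]; rfl
      have htag : ¬ rowTag T (natRow T t) = 0 := by rw [tagRow, hk]; simp [symTag]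
      rw [if_neg htag, hval] at hVt
      have hcl := count_link B X k 0 hk1
      by_cases hkc : k ≤ X.count B
      · have hpos := hle hkc
        have hlt : zeroPos B 0 X k < t := by
          have h1 := zeroPos_lt B X 0 k hk1 hkc
          rw [hX, length_numFrom, length_suffix T (by omega), ← hX, zero_add] at h1
          refine lt_of_le_of_ne (by omega) fun h2 => ?_
          rw [h2, suffix, List.getElem?_drop, show T.length - 1 - t + t = T.length - 1 by omega,
            (hd _).mpr rfl] at hpos
          simp at hpos
        rw [if_pos hkc] at hcl
        rw [if_neg (by omega)] at hVt
        refine ⟨f, fun q => ?_, fun i hi c' hc' => ?_⟩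
        · rw [hX', hc, List.count_cons_self, hcl, ← hf q, List.mem_cons, or_iff_right_iff_imp]
          rintro h
          rw [h]
          exact List.mem_of_getElem? hpos
        · rw [hc] at hc'
          cases i with
          | zero =>
            simp only [List.getElem?_cons_zero, Option.some.injEq] at hc'
            rw [Nat.sub_zero, hVt, ← hc']
            exact hfV _ hlt _ hpos
          | succ i =>
            rw [Nat.add_sub_add_right]
            exact hfV i (by omega) c' (by simpa using hc')
      · have hp := hgt (by omega)
        rw [if_neg hkc] at hcl
        rw [if_pos (by omega)] at hVt
        obtain ⟨g, hg1, hg2, hg3⟩ := perm_update pcode f hf hp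
        refine ⟨g, fun q => ?_, fun i hi c' hc' => ?_⟩
        · rw [hX', hc, List.count_cons_self, show (link B k 0 X).count B = X.count B by omega,
            ← hg3 q, List.mem_cons, Sum.inr.injEq]
        · rw [hc] at hc'
          cases i with
          | zero =>
            simp only [List.getElem?_cons_zero, Option.some.injEq] at hc'
            rw [Nat.sub_zero, hVt, ← hc']
            exact hg2.symm
          | succ i =>
            rw [Nat.add_sub_add_right]
            rw [List.getElem?_cons_succ] at hc'
            rw [hfV i (by omega) c' hc']
            cases c' with
            | inl e => rfl
            | inr q => simp only [Sum.elim_inr, hg1 q (List.mem_of_getElem? hc')]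

end

/-! ### Strings in memory -/

theorem getD_encode {α β : Type*} (f : α → ℕ) (g : β → ℕ) (w : List (α ⊕ β)) (j : ℕ) (c : α ⊕ β)
    (h : w[j]? = some c) : (encode f g w).getD (2 * j) 0 = symTag c ∧
      (encode f g w).getD (2 * j + 1) 0 = Sum.elim f g c := by
  induction w generalizing j with
  | nil => simp at h
  | cons x w ih =>
    cases j with
    | zero =>
      obtain rfl : x = c := by simpa using h
      cases x <;> simp [encode, symTag]
    | succ j =>
      have := ih j (by simpa using h)
      simp only [encode] at this
      cases x <;> simpa [encode, show 2 * (j + 1) = 2 * j + 1 + 1 by ring] using this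

theorem length_encode {α β : Type*} (f : α → ℕ) (g : β → ℕ) (w : List (α ⊕ β)) :
    (encode f g w).length = 2 * w.length := by
  induction w with
  | nil => rfl
  | cons x w ih =>
    simp only [encode] at ih
    cases x <;> simp [encode, ih] <;> ring

theorem getD_encode_lt {α β : Type*} {f : α → ℕ} {g : β → ℕ} {w : List (α ⊕ β)} {B : ℕ}
    (hB : 1 < B) (h : ∀ c ∈ w, Sum.elim f g c < B) (a : ℕ) : (encode f g w).getD a 0 < B := by
  rw [List.getD_eq_getElem?_getD]
  cases ha : (encode f g w)[a]? with
  | none => simp; omega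
  | some x =>
    have := List.mem_of_getElem? ha
    simp only [encode, List.mem_flatMap] at this
    obtain ⟨c, hc, hx⟩ := this
    have := h c hc
    cases c <;> simp at hx this ⊢ <;> omega

section
variable {S P : Type*} [LinearOrder S] [DecidableEq P] {scode : S ↪o ℕ} {B : ℕ}

theorem length_pbwt (T : List (S ⊕ P)) : (pbwt T).length = T.length := by simp [pbwt]

theorem getElem?_pbwt (T : List (S ⊕ P)) {j : ℕ} (hj : j < T.length) :
    (pbwt T)[j]? = some (rotSymbol (row T ⟨j, hj⟩)) := by
  simp [pbwt, hj, row]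

theorem rotSymbol_lt {w : List (S ⊕ P)} (hB : ∀ s, scode s < B) (hw : w.length < B) :
    Sum.elim scode id (rotSymbol w) < B := by
  unfold rotSymbol
  split
  · simp only [Sum.elim_inr, id]; omega
  · exact hB _
  · refine lt_of_le_of_lt (List.countP_le_length.trans ?_) hw
    simp [prevEnc]

/-- The tags `A` and values `V` found by the program are those of a renamed text. -/
theorem exists_pMatch (hB : ∀ s, scode s < B) {T : List (S ⊕ P)} (hT : EndMarked T) {σp : ℕ}
    (pcode : P ≃ Fin σp) {A V cell : ℕ → ℕ}
    (hcell : ∀ j < T.length, cell (2 * j) = A (T.length - 1 - j) ∧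
      cell (2 * j + 1) = if j = T.length - 1 then rowVal scode T (natRow T (T.length - 1))
        else V (T.length - 1 - j))
    (hA0 : A 0 = 0)
    (hA : ∀ k, k + 1 < T.length → A (k + 1) = if rowTag T (natRow T k) = 0 then 0 else 1)
    (hV : ∀ k, k + 1 < T.length → V (k + 1) =
      if rowTag T (natRow T k) = 0 then rowVal scode T (natRow T k) else
      if (numFrom scode B [] (suffix T k)).count B < rowVal scode T (natRow T k) then
        (numFrom scode B [] (suffix T k)).count B else
      V (k - zeroPos B 0 (numFrom scode B [] (suffix T k)) (rowVal scode T (natRow T k)))) :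
    ∃ T', PMatch T T' ∧ T'.length = T.length ∧ ∀ a < 2 * T.length,
      cell a = (encode scode (fun p => (pcode p : ℕ)) T').getD a 0 := by
  obtain ⟨d, -, hn, hd⟩ := getElem?_endMarked hT
  obtain ⟨f, -, hf⟩ := exists_renaming hB hT pcode hV (T.length - 1) (by omega)
  have hsuf : suffix T (T.length - 1) = T := by simp [suffix]
  rw [hsuf] at hf
  refine ⟨T.map (Sum.map id f), ⟨f, rfl⟩, List.length_map _, ?_⟩
  have main : ∀ j < T.length, ∀ c, T[j]? = some c → cell (2 * j) = symTag c ∧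
      cell (2 * j + 1) = Sum.elim scode (fun p => (pcode (f p) : ℕ)) c := by
    intro j hj c hc
    obtain ⟨h1, h2⟩ := hcell j hj
    rw [h1, h2]
    by_cases hj' : j = T.length - 1
    · rw [if_pos hj', hj', Nat.sub_self, hA0]
      obtain rfl : c = Sum.inl d := by
        rw [(hd j).mpr hj'] at hc
        exact (Option.some.inj hc).symm
      refine ⟨rfl, ?_⟩
      have hrow : row T (suffixRow T (T.length - 1) (by omega)) =
          T.take (T.length - 1) ++ [Sum.inl d] := by
        rw [row_suffixRow, hsuf, Nat.sub_self, List.take_zero, List.append_nil]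
        obtain ⟨m, hm⟩ : ∃ m, T.length = m + 1 := ⟨T.length - 1, by omega⟩
        have hlast := (hd m).mpr (by omega)
        rw [hm, Nat.add_sub_cancel]
        conv_lhs => rw [← List.take_length (l := T), hm, List.take_add_one, hlast]
        rfl
      rw [rowVal, dif_pos (by rw [natRow, dif_pos (by omega)]; exact Fin.is_lt _)]
      simp only [natRow, show T.length - 1 < T.length by omega, dif_pos, Fin.eta, hrow,
        rotSymbol_append_inl]
      rfl
    · rw [if_neg hj']
      refine ⟨?_, hf j (by omega) c hc⟩
      obtain ⟨k, hk⟩ : ∃ k, T.length - 1 - j = k + 1 := ⟨T.length - 1 - j - 1, by omega⟩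
      rw [hk, hA k (by omega), rowTag,
        dif_pos (by rw [natRow, dif_pos (by omega)]; exact Fin.is_lt _)]
      simp only [natRow, show k < T.length by omega, dif_pos, Fin.eta]
      obtain ⟨c', -, hc', h⟩ := suffix_step hB T (t := k) (by omega) rfl rfl
      rw [show T.length - 1 - (k + 1) = j by omega, hc, Option.some.injEq] at hc'
      subst hc'
      obtain ⟨e, rfl, he, -⟩ | ⟨p, m, rfl, he, -⟩ := h <;> rw [he] <;> simp [symTag]
  intro a ha
  have hj : a / 2 < T.length := by omega
  obtain ⟨c, hc⟩ : ∃ c, T[a / 2]? = some c := ⟨_, List.getElem?_eq_getElem hj⟩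
  obtain ⟨h1, h2⟩ := main _ hj c hc
  obtain ⟨g1, g2⟩ := getD_encode scode (fun p => (pcode p : ℕ)) (T.map (Sum.map id f)) (a / 2)
    (Sum.map id f c) (by rw [List.getElem?_map, hc]; rfl)
  rcases Nat.mod_two_eq_zero_or_one a with h | h
  · rw [show 2 * (a / 2) = a by omega] at h1 g1
    rw [h1, g1]
    cases c <;> rfl
  · rw [show 2 * (a / 2) + 1 = a by omega] at h2 g2
    rw [h2, g2]
    cases c <;> rfl

end

end PBWT

theorem theorem2 :
    ∃ (prog : PBWT.Prog) (C : ℕ),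
      ∀ (S : Type*) [LinearOrder S] (P : Type*) [DecidableEq P] (σp : ℕ)
        (scode : S ↪o ℕ) (pcode : P ≃ Fin σp) (T : List (S ⊕ P)) (B : ℕ),
        PBWT.EndMarked T →
        C * T.length ≤ B →
        (∀ s : S, scode s < B) →
        ∃ (T' : List (S ⊕ P)) (t : ℕ) (σ : PBWT.State),
          PBWT.PMatch T T' ∧
          PBWT.Exec (C * T.length) B prog (PBWT.inputState scode (PBWT.pbwt T)) t σ ∧
          t ≤ C * T.length ^ 2 ∧
          PBWT.Outputs scode (fun p => (pcode p : ℕ)) σ T' := by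
  open PBWT in
  -- Arrays have `20 * n` entries, and the loops nest to depth two, which gives the factor `400`.
  -- The memory holds sixteen arrays after the input.
  refine ⟨.seq (.add 2 (.reg 0) (.reg 0)) (inversionProg.code 0),
    400 * inversionProg.cost 1 + 1000, ?_⟩
  intro S _ P _ σp scode pcode T B hT hCB hB
  obtain ⟨d, -, hn, hd⟩ := getElem?_endMarked hT
  set K := inversionProg.cost 1 with hK
  set n := T.length with hnT
  have hC : 1000 * n ≤ (400 * K + 1000) * n := Nat.mul_le_mul_right _ (by omega)
  have hlen := length_pbwt T
  set σ₀ := inputState scode (pbwt T) with hσ₀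
  have hr0 : σ₀.reg 0 = n := hlen
  have hmem : ∀ c ∈ pbwt T, Sum.elim scode id c < B := by
    intro c hc
    obtain ⟨j, hj, rfl⟩ := List.getElem_of_mem hc
    have h1 := getElem?_pbwt T (hlen ▸ hj)
    rw [List.getElem?_eq_getElem hj, Option.some.injEq] at h1
    rw [h1]
    exact rotSymbol_lt hB (by rw [length_row]; omega)
  have hsane : Sane B n (σ₀.setReg 2 (2 * n)) := by
    refine ⟨fun r => ?_, fun a => getD_encode_lt (by omega) hmem a, by simp⟩
    rw [State.setReg_reg]
    split_ifs
    · omega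
    · simp only [hσ₀, inputState, hlen]
      split_ifs <;> omega
  have hout : ∀ a, 2 * n ≤ a → σ₀.mem a = 0 := by
    intro a ha
    simp only [hσ₀, inputState, List.getD_eq_getElem?_getD]
    rw [List.getElem?_eq_none (by rw [length_encode, hlen]; exact ha)]
    rfl
  obtain ⟨t, σ, hexec, ht, -, ⟨T', hmatch, hlen', hcell⟩, -⟩ :=
    inversionProg.exec_code (B := B) (n := n) (N := 20 * n) (M := (400 * K + 1000) * n)
      (by omega) (by omega) 0
      (fun s => ∃ T', PMatch T T' ∧ T'.length = n ∧ ∀ a < 2 * n,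
        s.cell a = (encode scode (fun p => (pcode p : ℕ)) T').getD a 0) _ hsane (by
        refine wp_inversionProg (inversion hB hT rfl) (by omega) (by omega) ?_ ?_ ?_ ?_ ?_
        · simpa [toSt] using hr0
        · simp [toSt, hσ₀, inputState]
        · intro j hj
          have := getD_encode scode id (pbwt T) j _ (getElem?_pbwt T hj)
          simp only [toSt, State.setReg_mem, hσ₀, inputState, rowTag, rowVal, dif_pos hj,
            if_pos (show 2 * j < 2 * n by omega), if_pos (show 2 * j + 1 < 2 * n by omega)]
          exact this
        · intro c x
          simp only [toSt, State.setReg_mem]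
          split_ifs
          · exact hout _ (by omega)
          · rfl
        · intro A V s' h1 h2 h3 h4
          exact exists_pMatch hB hT pcode h1 h2 h3 h4)
  have hadd : (Operand.reg 0).val σ₀ + (Operand.reg 0).val σ₀ = 2 * n := by
    simp only [Operand.val, hr0]; omega
  have h0 := Exec.add (M := (400 * K + 1000) * n) (B := B) σ₀ 2 (.reg 0) (.reg 0) (by omega)
  rw [hadd] at h0
  refine ⟨T', _, σ, hmatch, Exec.seq _ _ _ _ _ _ _ h0 hexec, ?_, ?_⟩
  · have h1 := inversionProg.cost_le (N := 20 * n) (by omega)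
    rw [show inversionProg.depth = 2 from rfl, ← hK] at h1
    have h2 : 1 ≤ n ^ 2 := Nat.one_le_pow _ _ hn
    nlinarith
  · intro a ha
    rw [hlen'] at ha
    rw [← hcell a ha]
    exact (if_pos ha).symm
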